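/- **Setting.** A *ringnet* of valence $m$ is an infinite quadrilateral mesh made of $m$ quarter-plane segments, indexed by $l\in\mathbb Z_m$, around one central element of valence $m$; all other vertices and faces have valence $4$. It is *primal* if the central element is a vertex (vertices $p^l_{ij}$, $i,j\ge 0$, with $p^l_{0j}=p^{l+1}_{j0}$) and *dual* if it is a face (vertices $p^l_{ij}$, $i,j\ge 1$). The refinement operator $R$ splits every face at its center (the average of its vertices) and every edge at its midpoint, the averaging operator $A$ connects the centers of adjacent faces, and the mid-edge operator $V$ connects the midpoints of adjacent edges. Let $$U=A^{a_s}V^{v_s}R^{r_s}\cdots A^{a_1}V^{v_1}R^{r_1},\qquad a=\sum_i a_i,\quad v=\sum_i v_i,\quad r=\sum_i r_i,$$ with nonnegative integer exponents, $a+v\ge1$, $v+r\ge1$ and $v$ even. (Each $V$ turns the segments by half a segment; since $v$ is even, $UN$ is labelled so that its segments have the same orientation as those of $N$.) Consider ringnets $N$ of the kind (primal or dual) that $U$ maps to itself. The *core* $N_c$ of $N$ consists of all vertices of $N$ that influence a vertex of the central element of $U^kN$ for some $k\ge1$. The *$c.\rho$-net* of $N$ consists of the core and the next $\rho$ rings of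 vertices around it, where each ring adds the vertices sharing a face with the previous net. The *subdivision matrix* $S$ is the matrix of $U$ restricted to $c.\rho$-nets. An eigenvalue $\mu$ is *the subdominant eigenvalue* if there is a dominant eigenvalue $d$ of algebraic multiplicity one with $|\mu|<|d|$, and every eigenvalue other than $d$ and $\mu$ has modulus less than $|\mu|$. The *scaling factor* of $U$ is $\sigma=\sigma(U)=2^{-r-v/2}$. The *primal grid mesh* $M$ of valence $m$ and frequency $f$, with segment angle $\varphi=2\pi f/m$, has the vertices $g^l_{ij}=i\,e^{\hat\imath l\varphi}+j\,e^{\hat\imath(l+1)\varphi}\in\mathbb C$, where $\hat\imath=\sqrt{-1}$; the *dual grid mesh* has the vertices $h^l_{ij}=\frac14(g^l_{i-1,j-1}+g^l_{i,j-1}+g^l_{i-1,j}+g^l_{ij})$, $i,j\ge1$. With $M$ the grid mesh of the kind that $U$ preserves, $\lambda_\varphi>0$ denotes the eigenvalue of the symmetric eigenmesh $M_\infty\neq 0$ of $U$ (restricted to core meshes) to which the normalized core meshes $(U^kM)_c/\|(U^kM)_c\|$ converge, for any norm. Here *symmetric* means $p^{l+1}_{ij}=e^{\hat\imath\varphi}p^l_{ij}$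 and $p^{m-1-l}_{ji}=\overline{p^l_{ij}}$. **Lemma (Scaling factor $\sigma$).** (a) For valence $m=4$ and every $\rho\ge0$, the scaling factor $\sigma(U)=2^{-r-v/2}$ is the subdominant eigenvalue of $U$ restricted to $c.\rho$-nets, that is, of the subdivision matrix $S$. (b) For all $m,f$ with $2f\pi/m=\pi/2$, one has $\lambda_{\pi/2}=\sigma(U)$; that is, the normalized core meshes of the grid mesh of valence $m$ and frequency $f$ converge, for any norm, to a symmetric nonzero eigenmesh of $U$ restricted to core meshes with eigenvalue $\sigma(U)$. -/

import Mathlib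

open Filter Topology

noncomputable section

namespace MidpointSubdivision

/-! ### Ringnets

A ringnet of valence `m` is an (infinite) quadrilateral mesh with one marked central element, around
which `m` quarter-plane segments, indexed by `l : ZMod m`, are glued. It is primal if the central
element is a vertex and dual if it is a face with `m` vertices. -/

inductive Kind : Type
  | primal
  | dual

def Kind.flip : Kind → Kind
  | .primal => .dual
  | .dual => .primal

/-- The vertices of a ringnet. In the usual double indexing of the `l`-th segment, primal vertices
are `g l i j` with `i, j ≥ 0`, where `g l 0 j = g (l+1) j 0` lies on the spoke between two segments
and all `g l 0 0` are the central vertex; so `pv l i j` stands for `g l (i+1) j`. Dual vertices are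
`h l i j` with `i, j ≥ 1`, the point `h l i j` having coordinates `(i - 1/2, j - 1/2)` in segment
`l`; so `dv l i j` stands for `h l (i+1) (j+1)`. -/
inductive Vertex (m : ℕ) : Kind → Type
  | center : Vertex m .primal
  | pv (l : ZMod m) (i j : ℕ) : Vertex m .primal
  | dv (l : ZMod m) (i j : ℕ) : Vertex m .dual

open Vertex

variable {m : ℕ}

/-- The primal vertex `g l i j`, `i, j ≥ 0`. -/
def g (l : ZMod m) : ℕ → ℕ → Vertex m .primal
  | 0, 0 => center
  | 0, j + 1 => pv (l + 1) j 0
  | i + 1, j => pv l i j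

/-- Scalar-valued meshes; a planar mesh is the same thing, with `ℝ²` identified with `ℂ`. -/
abbrev Mesh (m : ℕ) (k : Kind) : Type := Vertex m k → ℂ

/-! ### The operators `R`, `A`, `V`

The refined mesh `R N` is always primal and has half the spacing of `N`: its vertices are the
vertices, the edge midpoints and the face centers of `N`. -/

/-- The cell (vertex, edge or face) of a ringnet of kind `k` whose center is the vertex `x` of the
refined mesh, given by its vertices. A vertex is listed with multiplicity four and the two ends of
an edge with multiplicity two each (except for the central element); the multiplicities do not
affect the average over the cell. -/
def cell [NeZero m] : {k : Kind} → Vertex m .primal → Multiset (Vertex m k)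
  | .primal, center => {center}
  | .primal, pv l i j =>
      {g l ((i + 1) / 2) (j / 2), g l ((i + 1 + 1) / 2) (j / 2),
        g l ((i + 1) / 2) ((j + 1) / 2), g l ((i + 1 + 1) / 2) ((j + 1) / 2)}
  | .dual, center => (Finset.univ : Finset (ZMod m)).val.map fun l => dv l 0 0
  | .dual, pv l i 0 =>
      {dv l (i / 2) 0, dv l ((i + 1) / 2) 0, dv (l - 1) 0 (i / 2), dv (l - 1) 0 ((i + 1) / 2)}
  | .dual, pv l i (j + 1) =>
      {dv l (i / 2) (j / 2), dv l ((i + 1) / 2) (j / 2),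
        dv l (i / 2) ((j + 1) / 2), dv l ((i + 1) / 2) ((j + 1) / 2)}

/-- The faces of a ringnet are the vertices of its dual; this is the position of a face center in
the refined mesh. -/
def faceSite : {k : Kind} → Vertex m k.flip → Vertex m .primal
  | .primal, dv l i j => g l (2 * i + 1) (2 * j + 1)
  | .dual, center => center
  | .dual, pv l i j => g l (2 * (i + 1)) (2 * j)

/-- The vertices of `V N` are the edge midpoints of `N`, and they form a dual ringnet that is turned
by half a segment; its segment `l` is taken to be the one that is centered at the spoke `l` of `N`.
This is the position in the refined mesh of the edge midpoint that is the vertex `dv l a b` of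
`V N`; it has the coordinates `(a + b + 1, b - a)` with respect to the spoke `l`. -/
def edgeSite : Vertex m .dual → Vertex m .primal
  | dv l a b => if a ≤ b then g l (a + b + 1) (b - a) else g (l - 1) (a - b) (a + b + 1)

/-- The average of a mesh over a cell, as a linear functional. -/
def average {k : Kind} (s : Multiset (Vertex m k)) : Mesh m k →ₗ[ℂ] ℂ :=
  ((s.card : ℂ)⁻¹) • (s.map fun v => LinearMap.proj (R := ℂ) (φ := fun _ : Vertex m k => ℂ) v).sum

/-- The refinement operator: splits every face at its center. -/
def refineOp [NeZero m] (k : Kind) : Mesh m k →ₗ[ℂ] Mesh m .primal :=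
  LinearMap.pi fun x => average (cell x)

/-- The averaging operator: connects the centers of adjacent faces. -/
def averageOp [NeZero m] (k : Kind) : Mesh m k →ₗ[ℂ] Mesh m k.flip :=
  LinearMap.pi fun x => average (cell (faceSite x))

/-- The mid-edge operator: connects the midpoints of adjacent edges. -/
def midEdgeOp [NeZero m] (k : Kind) : Mesh m k →ₗ[ℂ] Mesh m .dual :=
  LinearMap.pi fun x => average (cell (edgeSite x))

inductive Op : Type
  | A
  | V
  | R

def Op.out : Op → Kind → Kind
  | .A, k => k.flip
  | .V, _ => .dual
  | .R, _ => .primal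

def Op.map [NeZero m] : (o : Op) → (k : Kind) → Mesh m k →ₗ[ℂ] Mesh m (o.out k)
  | .A, k => averageOp k
  | .V, k => midEdgeOp k
  | .R, k => refineOp k

/-- The kind of the result of a sequence of operators; the head of the list is applied first. -/
def outKind : List Op → Kind → Kind
  | [], k => k
  | o :: w, k => outKind w (o.out k)

def wordMap [NeZero m] : (w : List Op) → (k : Kind) → Mesh m k →ₗ[ℂ] Mesh m (outKind w k)
  | [], _ => LinearMap.id
  | o :: w, k => wordMap w (o.out k) ∘ₗ o.map k

/-! ### General midpoint subdivision operators -/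

/-- The exponents `[(a₁, v₁, r₁), …, (a_s, v_s, r_s)]` of
`U = A ^ a_s * V ^ v_s * R ^ r_s * ⋯ * A ^ a₁ * V ^ v₁ * R ^ r₁`. -/
abbrev Exponents : Type := List (ℕ × ℕ × ℕ)

namespace Exponents

/-- The total exponent `a` of `A`. -/
def totalA (e : Exponents) : ℕ := (e.map fun t => t.1).sum

/-- The total exponent `v` of `V`. -/
def totalV (e : Exponents) : ℕ := (e.map fun t => t.2.1).sum

/-- The total exponent `r` of `R`. -/
def totalR (e : Exponents) : ℕ := (e.map fun t => t.2.2).sum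

/-- The factors of `U`, in the order in which they are applied. -/
def word (e : Exponents) : List Op :=
  e.flatMap fun t =>
    List.replicate t.2.2 Op.R ++ List.replicate t.2.1 Op.V ++ List.replicate t.1 Op.A

/-- The scaling factor `σ(U) = 2 ^ (- r - v / 2)`. -/
def sigma (e : Exponents) : ℝ := (2 : ℝ) ^ (-(e.totalR : ℝ) - (e.totalV : ℝ) / 2)

/-- `U` maps ringnets of kind `k` to ringnets of the same kind. As soon as `U` has a factor `V` or
`R`, this holds for exactly one of the two kinds, the kind of all meshes `U N`. -/
def Preserves (e : Exponents) (k : Kind) : Prop := outKind e.word k = k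

end Exponents

/-- Rotation of the indices by one segment. -/
def rot : {k : Kind} → Vertex m k → Vertex m k
  | _, center => center
  | _, pv l i j => pv (l + 1) i j
  | _, dv l i j => dv (l + 1) i j

/-- Reflection of the indices: `g l i j ↦ g (m-1-l) j i` and `h l i j ↦ h (m-1-l) j i`. -/
def reflect : {k : Kind} → Vertex m k → Vertex m k
  | _, center => center
  | _, pv l i j => g (-1 - l) j (i + 1)
  | _, dv l i j => dv (-1 - l) j i

/-- The general midpoint subdivision operator `U` with exponents `e` on ringnets of valence `m` and
kind `k`, for an even number of factors `V`. Two factors `V` in the above labelling turn the spokes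
by one segment; this is undone by relabelling, so that the mesh keeps its orientation. -/
def subdivide [NeZero m] (e : Exponents) (k : Kind) (hk : e.Preserves k) :
    Mesh m k →ₗ[ℂ] Mesh m k :=
  LinearMap.funLeft ℂ ℂ (rot^[e.totalV / 2]) ∘ₗ
    (LinearEquiv.cast (R := ℂ) (M := Mesh m) hk).toLinearMap ∘ₗ wordMap e.word k

/-! ### Core mesh, `c.ρ`-nets and the subdivision matrix -/

/-- The vertices of the central vertex or face. -/
def centralVertices [NeZero m] (k : Kind) : Set (Vertex m k) := {v | v ∈ cell (k := k) center}

open Classical in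
/-- The core: all vertices influencing a vertex of the central element of `U ^ n N`, for some
`n ≥ 1`. -/
def core [NeZero m] (e : Exponents) (k : Kind) (hk : e.Preserves k) : Set (Vertex m k) :=
  {w | ∃ n : ℕ, 1 ≤ n ∧ ∃ v ∈ centralVertices k, ((subdivide e k hk) ^ n) (Pi.single w 1) v ≠ 0}

/-- Two vertices share a face. -/
def ShareFace [NeZero m] {k : Kind} (v w : Vertex m k) : Prop :=
  ∃ f : Vertex m k.flip, v ∈ cell (k := k) (faceSite f) ∧ w ∈ cell (k := k) (faceSite f)

/-- The `c.ρ`-net: the core and the next `ρ` rings of vertices around it. -/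
def coreNet [NeZero m] (e : Exponents) (k : Kind) (hk : e.Preserves k) : ℕ → Set (Vertex m k)
  | 0 => core e k hk
  | n + 1 => {v | ∃ w ∈ coreNet e k hk n, ShareFace v w}

open Classical in
/-- The subdivision matrix `S` as a linear map: `U` restricted to `c.ρ`-nets. (The `c.ρ`-net of
`U N` depends only on that of `N`, so the values given to the other vertices do not matter; they are
set to zero here.) -/
def subdivisionMatrix [NeZero m] (e : Exponents) (k : Kind) (hk : e.Preserves k) (ρ : ℕ) :
    Module.End ℂ (coreNet (m := m) e k hk ρ → ℂ) :=
  LinearMap.funLeft ℂ ℂ Subtype.val ∘ₗ subdivide e k hk ∘ₗ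
    Function.ExtendByZero.linearMap ℂ Subtype.val

/-- `μ` is the subdominant eigenvalue of `T`: there is a dominant eigenvalue `d` of algebraic
multiplicity one, and among the other eigenvalues `μ` is the only one of largest modulus. -/
def IsSubdominantEigenvalue {E : Type*} [AddCommGroup E] [Module ℂ E] (T : Module.End ℂ E)
    (μ : ℂ) : Prop :=
  ∃ d : ℂ, T.HasEigenvalue d ∧ Module.finrank ℂ (T.maxGenEigenspace d) = 1 ∧
    T.HasEigenvalue μ ∧ ‖μ‖ < ‖d‖ ∧
    ∀ ν : ℂ, T.HasEigenvalue ν → ν ≠ d → ν ≠ μ → ‖ν‖ < ‖μ‖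

/-! ### Grid meshes and the eigenvalue `λ_φ` -/

/-- The segment angle. -/
def segmentAngle (m f : ℕ) : ℝ := 2 * (f : ℝ) * Real.pi / (m : ℝ)

/-- The point `i e^{𝐢 l φ} + j e^{𝐢 (l+1) φ}`, where `φ` is the segment angle. -/
def gridPoint (f : ℕ) (l : ZMod m) (i j : ℕ) : ℂ :=
  (i : ℂ) * Complex.exp (Complex.I * ((l.val : ℂ) * (segmentAngle m f : ℂ))) +
    (j : ℂ) * Complex.exp (Complex.I * (((l.val : ℂ) + 1) * (segmentAngle m f : ℂ)))

/-- The primal or dual grid mesh of valence `m` and frequency `f`. -/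
def gridMesh (f : ℕ) : (k : Kind) → Mesh m k
  | _, center => 0
  | _, pv l i j => gridPoint f l (i + 1) j
  | _, dv l i j => (gridPoint f l i j + gridPoint f l (i + 1) j + gridPoint f l i (j + 1) +
      gridPoint f l (i + 1) (j + 1)) / 4

/-- A core mesh is symmetric with segment angle `φ`: it is rotation symmetric and its reflection is
its complex conjugate. -/
def IsSymmetric {k : Kind} {s : Set (Vertex m k)} (φ : ℝ) (M : s → ℂ) : Prop :=
  (∀ v w : s, w.1 = rot v.1 → M w = Complex.exp (Complex.I * (φ : ℂ)) * M v) ∧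
    ∀ v w : s, w.1 = reflect v.1 → M w = (starRingEnd ℂ) (M v)

/-- `lam` is the eigenvalue `λ_φ` for the valence `m` and the frequency `f` (with
`φ = 2 f π / m`): for any norm, the normalized core meshes of `U ^ n M`, where `M` is the grid mesh,
converge to a symmetric eigenmesh of `U` (restricted to core meshes) with the positive eigenvalue
`lam`. -/
def IsLambda (m : ℕ) [NeZero m] (e : Exponents) (k : Kind) (hk : e.Preserves k) (f : ℕ)
    (lam : ℝ) : Prop :=
  0 < lam ∧
    ∀ N : Seminorm ℝ (coreNet (m := m) e k hk 0 → ℂ), (∀ x, N x = 0 → x = 0) →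
      ∃ Minf : coreNet (m := m) e k hk 0 → ℂ,
        Tendsto
          (fun n : ℕ =>
            let Mn : coreNet (m := m) e k hk 0 → ℂ :=
              fun v => ((subdivide e k hk) ^ n) (gridMesh f k) v.1
            (N Mn)⁻¹ • Mn)
          atTop (𝓝 Minf) ∧
        IsSymmetric (segmentAngle m f) Minf ∧ Minf ≠ 0 ∧
        subdivisionMatrix e k hk 0 Minf = (lam : ℂ) • Minf

end MidpointSubdivision

end

open Filter Topology

noncomputable section

namespace MidpointSubdivision

open Vertex

/-! ### Averages and averaging operators -/

section Averaging

open scoped ComplexOrder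

variable {m : ℕ} {k k' k'' : Kind}

/-! Part (b) is an exact eigenvector computation. With segment angle π/2, the average of the grid
mesh over any cell is the center of that cell, so `A`, `V` and `R` map grid meshes to grid meshes,
multiplied by 1, (1 - i)/2 and 1/2 (`op_map_gridMesh`). Two factors `V` contribute -i/2, the
relabelling by `rot` cancels the quarter turns, and what remains is multiplication by σ
(`subdivide_gridMesh`). The normalized iterates of the grid mesh are therefore constant. It only has
to be excluded that the grid mesh vanishes on the core, that is, that the core is just the central
vertex (`exists_mem_core_gridMesh_ne_zero`).

For part (a), a ringnet of valence four is the lattice ℤ², and U becomes an operator on functions on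
ℤ² (`subdivide_pull`). The main estimate is that second differences of the iterates of a bounded
function decay like κ^n with κ < σ (`exists_second_differences_le`). It rests on two systems of
bounds: `DiagBound`, which gains 7/10 < 2^(-1/2) per factor `V`, and `AxisBound`, which in the
absence of `V` gains 3/4 from having both a factor `A` and a factor `R`. Interpolating the n-th
iterate by an affine function at three lattice points then gives U^n f = affine + o(σ^n) pointwise
(`exists_affine_approximation`).

Affine meshes are spanned by 1, the grid mesh and its conjugate, on which U acts by 1, σ and σ.
Hence (U - 1)(U - σ) annihilates them, and the iterates of any mesh in the image of (S - 1)(S - σ)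
are o(σ^n); such a mesh cannot be an eigenvector to an eigenvalue of modulus at least σ
(`eq_zero_of_eigenvector`). This excludes every such eigenvalue other than 1 and σ, and also a
Jordan block for 1. Applying U - σ alone shows that fixed meshes are constant (`eq_of_fixed`), so 1
is simple.

To pass between U and S, the nets must be finite and closed under influence. Finiteness of the core
holds because U shrinks distances by σ < 1 up to a constant (`hasReach_subdivide`, `finite_core`);
closedness of the rings holds because influence respects face sharing (`isInvariant_coreNet`). -/

theorem average_apply (s : Multiset (Vertex m k)) (f : Mesh m k) :
    average s f = (s.card : ℂ)⁻¹ * (s.map f).sum := by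
  have h : ∀ s : Multiset (Vertex m k),
      (s.map fun v => LinearMap.proj (R := ℂ) (φ := fun _ : Vertex m k => ℂ) v).sum f =
        (s.map f).sum := by
    intro s
    induction s using Multiset.induction_on with
    | empty => simp
    | cons a s ih => simp [ih]
  simp [average, h]

theorem average_four (a b c d : Vertex m k) (f : Mesh m k) :
    average {a, b, c, d} f = (f a + f b + f c + f d) / 4 := by
  rw [average_apply]
  simp only [Multiset.insert_eq_cons, Multiset.card_cons, Multiset.card_singleton,
    Multiset.map_cons, Multiset.map_singleton, Multiset.sum_cons, Multiset.sum_singleton]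
  push_cast
  ring

theorem average_singleton (a : Vertex m k) (f : Mesh m k) : average {a} f = f a := by
  simp [average_apply]

theorem average_const {s : Multiset (Vertex m k)} (hs : s ≠ 0) (c : ℂ) :
    average s (fun _ => c) = c := by
  have : (s.card : ℂ) ≠ 0 := by simpa using hs
  rw [average_apply]
  simp only [Multiset.map_const', Multiset.sum_replicate, nsmul_eq_mul]
  field_simp

theorem average_re (s : Multiset (Vertex m k)) (f : Mesh m k) :
    (average s f).re = (s.card : ℝ)⁻¹ * (s.map fun v => (f v).re).sum := by
  rw [average_apply]
  have h : ((s.map f).sum).re = (s.map fun v => (f v).re).sum := by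
    induction s using Multiset.induction_on with
    | empty => simp
    | cons a s ih => simp [ih]
  rw [← h, ← Complex.ofReal_natCast, ← Complex.ofReal_inv, Complex.re_ofReal_mul]

theorem average_re_lt_one {s : Multiset (Vertex m k)} {f : Mesh m k} (h : ∀ v, (f v).re ≤ 1)
    {v : Vertex m k} (hv : v ∈ s) (hlt : (f v).re < 1) : (average s f).re < 1 := by
  obtain ⟨t, rfl⟩ := Multiset.exists_cons_of_mem hv
  have ht : (t.map fun v => (f v).re).sum ≤ t.card := by
    clear hv
    induction t using Multiset.induction_on with
    | empty => simp
    | cons a t ih =>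
      simp only [Multiset.map_cons, Multiset.sum_cons, Multiset.card_cons, Nat.cast_add,
        Nat.cast_one]
      linarith [h a]
  rw [average_re]
  simp only [Multiset.map_cons, Multiset.sum_cons, Multiset.card_cons, Nat.cast_add, Nat.cast_one]
  rw [inv_mul_lt_iff₀ (by positivity)]
  linarith

theorem average_re_le_one {s : Multiset (Vertex m k)} {f : Mesh m k} (h : ∀ v, (f v).re ≤ 1) :
    (average s f).re ≤ 1 := by
  have ht : (s.map fun v => (f v).re).sum ≤ s.card := by
    induction s using Multiset.induction_on with
    | empty => simp
    | cons a t ih =>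
      simp only [Multiset.map_cons, Multiset.sum_cons, Multiset.card_cons, Nat.cast_add,
        Nat.cast_one]
      linarith [h a]
  rw [average_re]
  rcases Nat.eq_zero_or_pos s.card with h0 | h0
  · simp [h0]
  · rw [inv_mul_le_iff₀ (by positivity)]
    linarith

open Classical in
theorem average_single (s : Multiset (Vertex m k)) (w : Vertex m k) :
    average s (Pi.single w 1) = (s.card : ℂ)⁻¹ * s.count w := by
  rw [average_apply]
  congr 1
  induction s using Multiset.induction_on with
  | empty => simp
  | cons a s ih =>
    rw [Multiset.map_cons, Multiset.sum_cons, ih, Multiset.count_cons]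
    by_cases h : w = a
    · subst h; simp; ring
    · simp [h, Ne.symm h]

open Classical in
theorem average_single_ne_zero {s : Multiset (Vertex m k)} {w : Vertex m k} :
    average s (Pi.single w 1) ≠ 0 ↔ w ∈ s := by
  rw [average_single, ← Multiset.count_pos]
  constructor
  · intro h
    rw [Nat.pos_iff_ne_zero]
    rintro h0
    simp [h0] at h
  · intro h
    have : s.card ≠ 0 := by
      have := Multiset.count_le_card w s
      omega
    simp [h.ne', this]

open Classical in
/-- Each value of `T f` is a finite combination of values of `f` with nonnegative weights of sum
one. -/
structure IsAveraging (T : Mesh m k →ₗ[ℂ] Mesh m k') : Prop where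
  finite : ∀ v, ∃ t : Finset (Vertex m k), ∀ f : Mesh m k,
    T f v = ∑ x ∈ t, T (Pi.single x 1) v * f x
  nonneg : ∀ v x, 0 ≤ T (Pi.single x 1) v
  map_one : T 1 = 1

theorem IsAveraging.id : IsAveraging (LinearMap.id : Mesh m k →ₗ[ℂ] Mesh m k) where
  finite v := ⟨{v}, fun f => by simp⟩
  nonneg v x := by
    classical
    simp only [LinearMap.id_coe, id_eq, Pi.single_apply]
    split_ifs <;> simp
  map_one := rfl

theorem IsAveraging.comp {S : Mesh m k' →ₗ[ℂ] Mesh m k''} {T : Mesh m k →ₗ[ℂ] Mesh m k'}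
    (hS : IsAveraging S) (hT : IsAveraging T) : IsAveraging (S ∘ₗ T) where
  finite v := by
    classical
    obtain ⟨t, ht⟩ := hS.finite v
    choose u hu using hT.finite
    refine ⟨t.biUnion u, fun f => ?_⟩
    simp only [LinearMap.comp_apply]
    rw [ht]
    have h1 : ∀ y ∈ t, T f y = ∑ x ∈ t.biUnion u, T (Pi.single x 1) y * f x := by
      intro y hy
      rw [hu y f]
      refine Finset.sum_subset (Finset.subset_biUnion_of_mem u hy) fun x _ hx => ?_
      rw [hu y (Pi.single x 1), Finset.sum_eq_zero, zero_mul]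
      intro z hz
      rw [Pi.single_apply, if_neg, mul_zero]
      rintro rfl
      exact hx hz
    rw [Finset.sum_congr rfl fun y hy => by rw [h1 y hy, Finset.mul_sum], Finset.sum_comm]
    refine Finset.sum_congr rfl fun x _ => ?_
    rw [ht, Finset.sum_mul]
    exact Finset.sum_congr rfl fun y _ => by ring
  nonneg v x := by
    classical
    obtain ⟨t, ht⟩ := hS.finite v
    rw [LinearMap.comp_apply, ht]
    exact Finset.sum_nonneg fun y _ => mul_nonneg (hS.nonneg _ _) (hT.nonneg _ _)
  map_one := by rw [LinearMap.comp_apply, hT.map_one, hS.map_one]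

theorem IsAveraging.pow {T : Module.End ℂ (Mesh m k)} (hT : IsAveraging T) (n : ℕ) :
    IsAveraging (T ^ n) := by
  induction n with
  | zero => exact IsAveraging.id
  | succ n ih => exact ih.comp hT

open Classical in
theorem IsAveraging.exists_of_comp_ne_zero {S : Mesh m k' →ₗ[ℂ] Mesh m k''}
    {T : Mesh m k →ₗ[ℂ] Mesh m k'} (hS : IsAveraging S) {v : Vertex m k''} {w : Vertex m k}
    (h : S (T (Pi.single w 1)) v ≠ 0) :
    ∃ y, S (Pi.single y 1) v ≠ 0 ∧ T (Pi.single w 1) y ≠ 0 := by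
  obtain ⟨t, ht⟩ := hS.finite v
  rw [ht] at h
  obtain ⟨y, -, hy⟩ := Finset.exists_ne_zero_of_sum_ne_zero h
  exact ⟨y, left_ne_zero_of_mul hy, right_ne_zero_of_mul hy⟩

open Classical in
-- Nonnegative weights cannot cancel, so influence is transitive. This is what makes the core closed
-- under influence.
theorem IsAveraging.comp_ne_zero {S : Mesh m k' →ₗ[ℂ] Mesh m k''}
    {T : Mesh m k →ₗ[ℂ] Mesh m k'} (hS : IsAveraging S) (hT : IsAveraging T)
    {v : Vertex m k''} {y : Vertex m k'} {w : Vertex m k}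
    (hy : S (Pi.single y 1) v ≠ 0) (hw : T (Pi.single w 1) y ≠ 0) :
    S (T (Pi.single w 1)) v ≠ 0 := by
  obtain ⟨t, ht⟩ := hS.finite v
  have hyt : y ∈ t := by
    by_contra hyt
    apply hy
    rw [ht]
    refine Finset.sum_eq_zero fun x hx => ?_
    rw [Pi.single_apply, if_neg, mul_zero]
    rintro rfl
    exact hyt hx
  rw [ht]
  intro h0
  rw [Finset.sum_eq_zero_iff_of_nonneg
    (fun x _ => mul_nonneg (hS.nonneg v x) (hT.nonneg x w))] at h0
  exact mul_ne_zero hy hw (h0 y hyt)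

open Classical in
theorem IsAveraging.congr {T : Mesh m k →ₗ[ℂ] Mesh m k'} (hT : IsAveraging T) {v : Vertex m k'}
    {f g : Mesh m k} (h : ∀ w, T (Pi.single w 1) v ≠ 0 → f w = g w) : T f v = T g v := by
  obtain ⟨t, ht⟩ := hT.finite v
  rw [ht f, ht g]
  refine Finset.sum_congr rfl fun x _ => ?_
  by_cases h0 : T (Pi.single x 1) v = 0
  · simp [h0]
  · rw [h x h0]

open Classical in
theorem IsAveraging.exists_ne_zero {T : Mesh m k →ₗ[ℂ] Mesh m k'} (hT : IsAveraging T)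
    (v : Vertex m k') : ∃ w, T (Pi.single w 1) v ≠ 0 := by
  by_contra! h
  have := hT.congr (v := v) (f := 1) (g := 0) fun w hw => absurd (h w) hw
  simp [hT.map_one] at this

/-- Meshes carry the product topology, and each value of the image depends on finitely many values.
Pointwise limits can thus be taken through U although the mesh is infinite. -/
theorem IsAveraging.continuous {T : Mesh m k →ₗ[ℂ] Mesh m k'} (hT : IsAveraging T) :
    Continuous T := by
  refine continuous_pi fun v => ?_
  obtain ⟨t, ht⟩ := hT.finite v
  rw [funext ht]
  fun_prop

theorem IsAveraging.map_star {T : Mesh m k →ₗ[ℂ] Mesh m k'} (hT : IsAveraging T) (f : Mesh m k) :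
    T (star f) = star (T f) := by
  funext v
  obtain ⟨t, ht⟩ := hT.finite v
  rw [ht, Pi.star_apply, ht f, star_sum]
  refine Finset.sum_congr rfl fun x _ => ?_
  rw [star_mul', Pi.star_apply, (IsSelfAdjoint.of_nonneg (hT.nonneg v x)).star_eq]

theorem isAveraging_funLeft {m : ℕ} {k k' : Kind} (σ : Vertex m k' → Vertex m k) :
    IsAveraging (LinearMap.funLeft ℂ ℂ σ : Mesh m k →ₗ[ℂ] Mesh m k') where
  finite v := ⟨{σ v}, fun f => by
    simp only [Finset.sum_singleton, LinearMap.funLeft_apply, Pi.single_eq_same, one_mul]⟩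
  nonneg v x := by
    classical
    rw [LinearMap.funLeft_apply]
    exact (Pi.single_nonneg (α := fun _ : Vertex m k => ℂ)).2 zero_le_one (σ v)
  map_one := rfl

theorem isAveraging_cast {m : ℕ} {k k' : Kind} (h : k' = k) :
    IsAveraging (LinearEquiv.cast (R := ℂ) (M := Mesh m) h).toLinearMap := by
  subst h
  exact IsAveraging.id

end Averaging

/-! ### The subdivision operator as a composition of averaging operators -/

section Operators

open scoped ComplexOrder

variable {m : ℕ} [NeZero m]

theorem cell_ne_zero {k : Kind} (x : Vertex m .primal) : cell (k := k) x ≠ 0 := by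
  have hm := NeZero.ne m
  rw [← Multiset.card_pos]
  rcases k with _ | _ <;> rcases x with _ | ⟨l, i, j⟩ <;> try rcases j with _ | j
  all_goals simp [cell, Nat.pos_of_ne_zero hm]

/-- The position in the refined mesh of the cell over which an operator averages. -/
def Op.site : (o : Op) → {k : Kind} → Vertex m (o.out k) → Vertex m .primal
  | .A, _, x => faceSite x
  | .V, _, x => edgeSite x
  | .R, _, x => x

theorem Op.map_apply (o : Op) (k : Kind) (f : Mesh m k) (x : Vertex m (o.out k)) :
    o.map k f x = average (cell (o.site x)) f := by
  cases o <;> rfl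

theorem isAveraging_op (o : Op) (k : Kind) : IsAveraging (o.map (m := m) k) where
  finite v := by
    classical
    refine ⟨(cell (o.site v)).toFinset, fun f => ?_⟩
    simp_rw [Op.map_apply]
    rw [average_apply, Finset.sum_multiset_map_count, Finset.mul_sum]
    refine Finset.sum_congr rfl fun x _ => ?_
    rw [average_single, nsmul_eq_mul, mul_assoc]
  nonneg v x := by
    rw [Op.map_apply, average_single]
    exact mul_nonneg (by simp) (by simp)
  map_one := by
    funext v
    rw [Op.map_apply]
    exact average_const (cell_ne_zero _) 1

theorem isAveraging_wordMap (w : List Op) (k : Kind) : IsAveraging (wordMap (m := m) w k) := by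
  induction w generalizing k with
  | nil => exact IsAveraging.id
  | cons o w ih => exact (ih _).comp (isAveraging_op o k)

theorem isAveraging_subdivide (e : Exponents) (k : Kind) (hk : e.Preserves k) :
    IsAveraging (subdivide (m := m) e k hk) :=
  (isAveraging_funLeft _).comp ((isAveraging_cast hk).comp (isAveraging_wordMap _ _))

end Operators

/-! ### Words and their scaling factors -/

def Op.scale : Op → ℝ
  | .A => 1
  | .V => (√2)⁻¹
  | .R => 2⁻¹

/-- The scaling factor of a word in the three operators. -/
def wordScale (w : List Op) : ℝ := (w.map Op.scale).prod

theorem wordScale_cons (o : Op) (w : List Op) : wordScale (o :: w) = o.scale * wordScale w := by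
  simp [wordScale]

theorem Op.scale_pos (o : Op) : 0 < o.scale := by
  cases o <;> simp [Op.scale]

theorem wordScale_pos (w : List Op) : 0 < wordScale w := by
  induction w with
  | nil => simp [wordScale]
  | cons o w ih => rw [wordScale_cons]; exact mul_pos o.scale_pos ih

namespace Exponents

/-- Scaling factors, complex factors and contraction rates are all multiplicative in the word, so
this one formula evaluates them by the total exponents. -/
theorem prod_map_word {α : Type*} [CommMonoid α] (φ : Op → α) (e : Exponents) :
    (e.word.map φ).prod = φ .A ^ e.totalA * φ .V ^ e.totalV * φ .R ^ e.totalR := by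
  induction e with
  | nil => simp [word, totalA, totalV, totalR]
  | cons t e ih =>
    simp only [word, totalA, totalV, totalR, List.flatMap_cons, List.map_append, List.prod_append,
      List.map_replicate, List.prod_replicate, List.map_cons, List.sum_cons, pow_add] at ih ⊢
    rw [ih]
    ac_rfl

theorem sigma_eq_wordScale (e : Exponents) : e.sigma = wordScale e.word := by
  have h : (2 : ℝ) ^ ((e.totalV : ℝ) / 2) = √2 ^ e.totalV := by
    rw [Real.sqrt_eq_rpow, ← Real.rpow_natCast, ← Real.rpow_mul two_pos.le]
    congr 1
    ring
  rw [wordScale, prod_map_word, sigma, Real.rpow_sub two_pos, Real.rpow_neg two_pos.le,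
    Real.rpow_natCast, h]
  simp only [Op.scale, one_pow, inv_pow]
  ring

theorem mem_word_iff (e : Exponents) :
    (.A ∈ e.word ↔ e.totalA ≠ 0) ∧ (.V ∈ e.word ↔ e.totalV ≠ 0) ∧
      (.R ∈ e.word ↔ e.totalR ≠ 0) := by
  simp [word, totalA, totalV, totalR, List.sum_eq_zero_iff]
  constructor <;> constructor <;> aesop

end Exponents

/-! ### The grid mesh with right-angled segments is an eigenmesh -/

section Grid

variable {m : ℕ}

/-- The direction of the spoke `l` of the grid mesh with segment angle `π / 2`. -/
def spoke (l : ZMod m) : ℂ := Complex.I ^ l.val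

theorem eq_four_mul_of_segmentAngle {m f : ℕ} (hφ : segmentAngle m f = Real.pi / 2) :
    m = 4 * f := by
  have hm : (m : ℝ) ≠ 0 := by
    intro h
    rw [segmentAngle, h, div_zero] at hφ
    linarith [Real.pi_pos]
  rw [segmentAngle, div_eq_div_iff hm two_ne_zero] at hφ
  have : (m : ℝ) = 4 * f := by
    have := Real.pi_pos.ne'
    have h2 : Real.pi * m = Real.pi * (4 * f) := by linarith
    exact mul_left_cancel₀ this h2
  exact_mod_cast this

variable {f : ℕ} (hφ : segmentAngle m f = Real.pi / 2)

include hφ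

/-- The angle π/2 forces m = 4f. This makes powers of i well defined on indices modulo m, so that
`spoke` turns sums into products. -/
theorem I_pow_eq_one : Complex.I ^ m = 1 := by
  rw [eq_four_mul_of_segmentAngle hφ, pow_mul, Complex.I_pow_four, one_pow]

theorem spoke_add [NeZero m] (a b : ZMod m) : spoke (a + b) = spoke a * spoke b := by
  rw [spoke, spoke, spoke, ZMod.val_add, ← pow_eq_pow_mod _ (I_pow_eq_one hφ), pow_add]

theorem spoke_one [NeZero m] : spoke (1 : ZMod m) = Complex.I := by
  rw [spoke, ZMod.val_one_eq_one_mod, ← pow_eq_pow_mod _ (I_pow_eq_one hφ), pow_one]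

theorem spoke_add_one [NeZero m] (l : ZMod m) : spoke (l + 1) = Complex.I * spoke l := by
  rw [spoke_add hφ, spoke_one hφ, mul_comm]

theorem spoke_sub_one [NeZero m] (l : ZMod m) : spoke (l - 1) = -Complex.I * spoke l := by
  have := spoke_add_one hφ (l - 1)
  rw [sub_add_cancel] at this
  rw [this, ← mul_assoc, neg_mul, Complex.I_mul_I, neg_neg, one_mul]

omit hφ in
theorem spoke_ne_zero (l : ZMod m) : spoke l ≠ 0 := pow_ne_zero _ Complex.I_ne_zero

theorem spoke_mul_spoke_neg [NeZero m] (l : ZMod m) : spoke l * spoke (-l) = 1 := by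
  rw [← spoke_add hφ, add_neg_cancel, spoke, ZMod.val_zero, pow_zero]

omit hφ in
theorem spoke_mul_conj (l : ZMod m) : spoke l * (starRingEnd ℂ) (spoke l) = 1 := by
  rw [spoke, map_pow, ← mul_pow, Complex.conj_I, mul_neg, Complex.I_mul_I, neg_neg, one_pow]

theorem spoke_neg [NeZero m] (l : ZMod m) : spoke (-l) = (starRingEnd ℂ) (spoke l) :=
  mul_left_cancel₀ (spoke_ne_zero l) ((spoke_mul_spoke_neg hφ l).trans (spoke_mul_conj l).symm)

/-- Shifting the index multiplies the sum by i. This centers the central face of the dual grid mesh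
at the origin. -/
theorem sum_spoke [NeZero m] : ∑ l : ZMod m, spoke l = 0 := by
  have h : ∑ l : ZMod m, spoke l = Complex.I * ∑ l : ZMod m, spoke l := by
    rw [Finset.mul_sum, ← Equiv.sum_comp (Equiv.addRight (1 : ZMod m))]
    exact Finset.sum_congr rfl fun l _ => spoke_add_one hφ l
  have h2 : (1 - Complex.I) * ∑ l : ZMod m, spoke l = 0 := by
    rw [sub_mul, one_mul, ← h, sub_self]
  refine (mul_eq_zero.1 h2).resolve_left fun h0 => ?_
  simpa using congrArg Complex.im h0

theorem exp_segmentAngle : Complex.exp (Complex.I * (segmentAngle m f : ℂ)) = Complex.I := by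
  rw [hφ, mul_comm]
  push_cast
  exact Complex.exp_pi_div_two_mul_I

theorem gridPoint_eq (l : ZMod m) (i j : ℕ) :
    gridPoint f l i j = (i + Complex.I * j) * spoke l := by
  have h (n : ℕ) : Complex.exp (Complex.I * ((n : ℂ) * (segmentAngle m f : ℂ))) =
      Complex.I ^ n := by
    rw [mul_left_comm, Complex.exp_nat_mul, exp_segmentAngle hφ]
  have h1 := h (l.val + 1)
  push_cast at h1
  rw [gridPoint, h, h1, spoke]
  ring

variable [NeZero m]

theorem gridMesh_g (l : ZMod m) (i j : ℕ) :
    gridMesh f .primal (g l i j) = (i + Complex.I * j) * spoke l := by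
  rcases i with _ | i
  · rcases j with _ | j
    · simp [g, gridMesh]
    · simp only [g, gridMesh, gridPoint_eq hφ, spoke_add_one hφ]
      push_cast
      ring
  · simp only [g, gridMesh, gridPoint_eq hφ]

omit [NeZero m] in
theorem gridMesh_dv (l : ZMod m) (i j : ℕ) :
    gridMesh f .dual (dv l i j) = ((i + 1 / 2) + Complex.I * (j + 1 / 2)) * spoke l := by
  simp only [gridMesh, gridPoint_eq hφ]
  push_cast
  ring

omit hφ in
theorem half_add_half (i : ℕ) : (((i / 2 : ℕ) : ℂ) + ((i + 1) / 2 : ℕ)) = i := by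
  norm_cast
  omega

/-- The grid coordinates are linear in each segment, and the floor and the ceiling of n/2 add up to
n, whatever the parity. The factor 1/2 is the halved spacing of the refined mesh. Cells across a
spoke work because neighbouring spokes differ by the factor i, and the central face because the
spokes sum to zero. -/
theorem average_cell_gridMesh {k : Kind} (x : Vertex m .primal) :
    average (cell x) (gridMesh f k) = 2⁻¹ * gridMesh f .primal x := by
  rcases k with _ | _ <;> rcases x with _ | ⟨l, i, j⟩
  · simp [cell, average_singleton, gridMesh]
  · have h1 := half_add_half (i + 1)
    have h2 := half_add_half j
    have h3 := gridMesh_g hφ l (i + 1) j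
    simp only [g] at h3
    simp only [cell, average_four, gridMesh_g hφ, h3]
    push_cast at h1 ⊢
    linear_combination (1 / 2 * spoke l) * h1 + (1 / 2 * Complex.I * spoke l) * h2
  · rw [average_apply]
    simp only [cell, Multiset.map_map, Function.comp_def, gridMesh_dv hφ]
    have : (Multiset.map (fun l : ZMod m => (((0 : ℕ) : ℂ) + 1 / 2 +
        Complex.I * (((0 : ℕ) : ℂ) + 1 / 2)) * spoke l) Finset.univ.val).sum = 0 := by
      change ∑ l : ZMod m, _ = _
      rw [← Finset.mul_sum, sum_spoke hφ, mul_zero]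
    rw [this]
    simp [gridMesh]
  · have h1 := half_add_half i
    have h3 := gridMesh_g hφ l (i + 1) j
    simp only [g] at h3
    rw [h3]
    rcases j with _ | j
    · simp only [cell, average_four, gridMesh_dv hφ, spoke_sub_one hφ]
      push_cast
      linear_combination (1 / 2 * spoke l) * h1 +
        (1 / 4 * spoke l) * (-1 - (((i / 2 : ℕ) : ℂ) + ((i + 1) / 2 : ℕ)) ) * Complex.I_sq
    · have h2 := half_add_half j
      simp only [cell, average_four, gridMesh_dv hφ]
      push_cast
      linear_combination (1 / 2 * spoke l) * h1 + (1 / 2 * Complex.I * spoke l) * h2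

end Grid

theorem wordMap_cons_apply {m : ℕ} [NeZero m] (o : Op) (w : List Op) (k : Kind) (f : Mesh m k) :
    wordMap (o :: w) k f = wordMap w (o.out k) (o.map k f) := rfl

/-- The factor by which an operator scales and turns the grid mesh. -/
def Op.factor : Op → ℂ
  | .A => 1
  | .V => (1 - Complex.I) / 2
  | .R => 2⁻¹

/-! ### The grid mesh under the operators, rotation and reflection -/

section Grid

variable {m f : ℕ} [NeZero m] (hφ : segmentAngle m f = Real.pi / 2)

include hφ

theorem gridMesh_faceSite {k : Kind} (x : Vertex m k.flip) :
    gridMesh f .primal (faceSite x) = 2 * gridMesh f k.flip x := by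
  rcases k with _ | _
  · rcases x with _ | _ | ⟨l, i, j⟩
    have := gridMesh_dv hφ l i j
    simp only [faceSite, gridMesh_g hφ, Kind.flip]
    rw [this]
    push_cast
    ring
  · rcases x with _ | ⟨l, i, j⟩
    · simp [faceSite, gridMesh]
    · have := gridMesh_g hφ l (i + 1) j
      simp only [g] at this
      simp only [faceSite, gridMesh_g hφ, Kind.flip]
      rw [this]
      push_cast
      ring

theorem gridMesh_edgeSite (x : Vertex m .dual) :
    gridMesh f .primal (edgeSite x) = (1 - Complex.I) * gridMesh f .dual x := by
  rcases x with _ | _ | ⟨l, a, b⟩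
  rw [edgeSite, gridMesh_dv hφ]
  split_ifs with h
  · rw [gridMesh_g hφ]
    push_cast [h]
    linear_combination (spoke l * (b + 1 / 2)) * Complex.I_sq
  · rw [gridMesh_g hφ, spoke_sub_one hφ]
    push_cast [(not_le.1 h).le]
    linear_combination (-spoke l * (a + 1 / 2)) * Complex.I_sq

theorem op_map_gridMesh (o : Op) (k : Kind) :
    o.map k (gridMesh (m := m) f k) = o.factor • gridMesh f (o.out k) := by
  funext x
  rw [Op.map_apply, average_cell_gridMesh hφ, Pi.smul_apply, smul_eq_mul]
  cases o with
  | A =>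
    have := gridMesh_faceSite hφ x
    simp only [Op.site, Op.factor, Op.out]
    rw [this]
    ring
  | V =>
    have := gridMesh_edgeSite hφ x
    simp only [Op.site, Op.factor, Op.out]
    rw [this]
    ring
  | R => simp only [Op.site, Op.factor, Op.out]

theorem wordMap_gridMesh (w : List Op) (k : Kind) :
    wordMap w k (gridMesh (m := m) f k) = (w.map Op.factor).prod • gridMesh f (outKind w k) := by
  induction w generalizing k with
  | nil => exact (one_smul ℂ _).symm
  | cons o w ih =>
    rw [wordMap_cons_apply, op_map_gridMesh hφ, map_smul, ih, smul_smul, List.map_cons,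
      List.prod_cons]
    rfl

theorem gridMesh_rot {k : Kind} (v : Vertex m k) :
    gridMesh f k (rot v) = Complex.I * gridMesh f k v := by
  rcases v with _ | ⟨l, i, j⟩ | ⟨l, i, j⟩
  · simp [rot, gridMesh]
  · simp only [rot, gridMesh, gridPoint_eq hφ, spoke_add_one hφ]
    ring
  · simp only [rot, gridMesh_dv hφ, spoke_add_one hφ]
    ring

theorem gridMesh_rot_iterate {k : Kind} (n : ℕ) (v : Vertex m k) :
    gridMesh f k (rot^[n] v) = Complex.I ^ n * gridMesh f k v := by
  induction n generalizing v with
  | zero => simp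
  | succ n ih => rw [Function.iterate_succ_apply, ih, gridMesh_rot hφ, pow_succ, mul_assoc]

theorem gridMesh_reflect {k : Kind} (v : Vertex m k) :
    gridMesh f k (reflect v) = (starRingEnd ℂ) (gridMesh f k v) := by
  have h (l : ZMod m) : spoke (-1 - l) = -Complex.I * (starRingEnd ℂ) (spoke l) := by
    rw [← spoke_neg hφ, ← spoke_sub_one hφ]
    congr 1
    ring
  rcases v with _ | ⟨l, i, j⟩ | ⟨l, i, j⟩
  · simp [reflect, gridMesh]
  · have h3 := gridMesh_g hφ l (i + 1) j
    simp only [g] at h3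
    simp only [reflect, gridMesh_g hφ, h3, h, map_mul, map_add, Complex.conj_I, map_natCast]
    linear_combination (-(starRingEnd ℂ) (spoke l) * ((i + 1 : ℕ) : ℂ)) * Complex.I_sq
  · simp only [reflect, gridMesh_dv hφ, h, map_mul, map_add, Complex.conj_I, map_natCast,
      map_div₀, map_one, map_ofNat]
    linear_combination (-(starRingEnd ℂ) (spoke l) * ((i : ℂ) + 1 / 2)) * Complex.I_sq

theorem gridMesh_primal_ne_zero {v : Vertex m .primal} (hv : v ≠ center) :
    gridMesh f .primal v ≠ 0 := by
  rcases v with _ | ⟨l, i, j⟩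
  · exact absurd rfl hv
  · have := gridMesh_g hφ l (i + 1) j
    simp only [g] at this
    rw [this]
    refine mul_ne_zero (fun h => ?_) (spoke_ne_zero l)
    have := congrArg Complex.re h
    simp at this
    norm_cast at this

omit [NeZero m] in
theorem gridMesh_dual_ne_zero (v : Vertex m .dual) : gridMesh f .dual v ≠ 0 := by
  rcases v with _ | _ | ⟨l, i, j⟩
  rw [gridMesh_dv hφ]
  refine mul_ne_zero (fun h => ?_) (spoke_ne_zero l)
  have := congrArg Complex.re h
  simp at this
  have h2 : (0 : ℝ) < i + 2⁻¹ := by positivity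
  exact h2.ne' this

end Grid

theorem cast_gridMesh {m f : ℕ} {k k' : Kind} (h : k' = k) :
    LinearEquiv.cast (R := ℂ) (M := Mesh m) h (gridMesh f k') = gridMesh f k := by
  subst h
  rfl

/-- Since ((1 - i)/2)² = -i/2, each pair of factors `V` scales by 1/2 and turns by -i; the
relabelling supplies one factor i per pair. -/
theorem factor_prod (e : Exponents) (hv : Even e.totalV) :
    (e.word.map Op.factor).prod * Complex.I ^ (e.totalV / 2) = (e.sigma : ℂ) := by
  obtain ⟨n, hn⟩ := hv
  rw [e.sigma_eq_wordScale, wordScale, e.prod_map_word, e.prod_map_word, hn, ← two_mul,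
    Nat.mul_div_cancel_left n two_pos, pow_mul, pow_mul]
  simp only [Op.factor, Op.scale, one_pow, one_mul]
  have h1 : ((1 - Complex.I) / 2) ^ 2 = 2⁻¹ * -Complex.I := by
    linear_combination (1 / 4) * Complex.I_sq
  have h2 : ((√2)⁻¹ : ℝ) ^ 2 = 2⁻¹ := by
    rw [inv_pow, Real.sq_sqrt two_pos.le]
  rw [h1, h2, mul_pow, neg_pow]
  push_cast
  have h3 : (-1 : ℂ) ^ n * Complex.I ^ n * Complex.I ^ n = 1 := by
    rw [← mul_pow, ← mul_pow]
    simp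
  linear_combination ((2⁻¹ : ℂ) ^ n * 2⁻¹ ^ e.totalR) * h3

theorem subdivide_gridMesh {m f : ℕ} [NeZero m] (hφ : segmentAngle m f = Real.pi / 2)
    (e : Exponents) (hv : Even e.totalV) (k : Kind) (hk : e.Preserves k) :
    subdivide e k hk (gridMesh (m := m) f k) = (e.sigma : ℂ) • gridMesh f k := by
  simp only [subdivide, LinearMap.comp_apply, wordMap_gridMesh hφ, map_smul]
  have := cast_gridMesh (m := m) (f := f) hk
  simp only [LinearEquiv.coe_coe]
  rw [this]
  funext v
  rw [Pi.smul_apply, LinearMap.funLeft_apply, gridMesh_rot_iterate hφ, ← factor_prod e hv,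
    Pi.smul_apply, smul_eq_mul, smul_eq_mul, mul_assoc]

/-! ### The restriction of an averaging operator to an invariant set of vertices -/

section Restriction

variable {m : ℕ} {k : Kind}

open Classical in
/-- The values of `T f` on `s` depend only on those of `f` on `s`. -/
def IsInvariant (T : Module.End ℂ (Mesh m k)) (s : Set (Vertex m k)) : Prop :=
  ∀ v ∈ s, ∀ w, T (Pi.single w 1) v ≠ 0 → w ∈ s

def restrict (s : Set (Vertex m k)) : Mesh m k →ₗ[ℂ] (s → ℂ) :=
  LinearMap.funLeft ℂ ℂ Subtype.val

theorem restrict_apply (s : Set (Vertex m k)) (f : Mesh m k) (v : s) : restrict s f v = f v := rfl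

theorem subdivisionMatrix_restrict [NeZero m] {e : Exponents} {hk : e.Preserves k} {ρ : ℕ}
    (h : IsInvariant (subdivide (m := m) e k hk) (coreNet e k hk ρ)) (f : Mesh m k) :
    subdivisionMatrix e k hk ρ (restrict _ f) = restrict _ (subdivide e k hk f) := by
  funext v
  refine (isAveraging_subdivide e k hk).congr fun w hw => ?_
  have hwm := h v.1 v.2 w (by convert hw)
  exact Subtype.val_injective.extend_apply _ _ (⟨w, hwm⟩ : coreNet (m := m) e k hk ρ)

theorem subdivisionMatrix_pow_restrict [NeZero m] {e : Exponents} {hk : e.Preserves k} {ρ : ℕ}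
    (h : IsInvariant (subdivide (m := m) e k hk) (coreNet e k hk ρ)) (n : ℕ) (f : Mesh m k) :
    (subdivisionMatrix e k hk ρ ^ n) (restrict _ f) = restrict _ ((subdivide e k hk ^ n) f) := by
  induction n generalizing f with
  | zero => rfl
  | succ n ih => rw [pow_succ, pow_succ, Module.End.mul_apply, Module.End.mul_apply,
      subdivisionMatrix_restrict h, ih]

theorem isInvariant_core [NeZero m] (e : Exponents) (hk : e.Preserves k) :
    IsInvariant (subdivide (m := m) e k hk) (core e k hk) := by
  classical
  rintro v ⟨n, hn, c, hc, hv⟩ w hw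
  refine ⟨n + 1, by omega, c, hc, ?_⟩
  rw [pow_succ, Module.End.mul_apply]
  refine ((isAveraging_subdivide e k hk).pow n).comp_ne_zero (isAveraging_subdivide e k hk)
    (y := v) ?_ ?_
  · convert hv
  · convert hw

theorem mem_core [NeZero m] {e : Exponents} {hk : e.Preserves k} {v w : Vertex m k}
    (hv : v ∈ centralVertices k) [DecidableEq (Vertex m k)]
    (hw : subdivide e k hk (Pi.single w 1) v ≠ 0) : w ∈ core e k hk := by
  refine ⟨1, le_rfl, v, hv, ?_⟩
  rw [pow_one]
  convert hw

theorem exists_mem_centralVertices [NeZero m] (k : Kind) :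
    ∃ v : Vertex m k, v ∈ centralVertices k :=
  Multiset.exists_mem_of_ne_zero (cell_ne_zero _)

end Restriction

/-! ### The core is larger than the central vertex -/

section CoreSize

variable {m : ℕ} [NeZero m]

def IsCenter : {k : Kind} → Vertex m k → Prop
  | _, center => True
  | _, pv _ _ _ => False
  | _, dv _ _ _ => False

omit [NeZero m] in
theorem not_isCenter_iff {v : Vertex m .primal} : ¬ IsCenter v ↔ v ≠ center := by
  rcases v with _ | _ <;> simp [IsCenter]

/-- A mesh whose values have real part at most one, with equality at most at a central vertex. -/
def PeaksAtCenter {k : Kind} (f : Mesh m k) : Prop :=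
  ∀ v, (f v).re ≤ 1 ∧ (¬ IsCenter v → (f v).re < 1)

theorem exists_mem_cell_not_isCenter {k : Kind} {x : Vertex m .primal} (hx : x ≠ center) :
    ∃ v ∈ cell (k := k) x, ¬ IsCenter v := by
  rcases k with _ | _
  · rcases x with _ | ⟨l, i, j⟩
    · exact absurd rfl hx
    · refine ⟨g l ((i + 1 + 1) / 2) (j / 2), by simp [cell], ?_⟩
      rw [show (i + 1 + 1) / 2 = i / 2 + 1 by omega]
      simp [g, IsCenter]
  · obtain ⟨v, hv⟩ := Multiset.exists_mem_of_ne_zero (cell_ne_zero (k := .dual) x)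
    refine ⟨v, hv, ?_⟩
    rcases v with _ | _ | _
    simp [IsCenter]

theorem Op.map_re_lt_one (o : Op) {k : Kind} {f : Mesh m k} (hf : ∀ v, (f v).re < 1)
    (x : Vertex m (o.out k)) : (o.map k f x).re < 1 := by
  obtain ⟨v, hv⟩ := Multiset.exists_mem_of_ne_zero (cell_ne_zero (k := k) (o.site x))
  rw [Op.map_apply]
  exact average_re_lt_one (fun v => (hf v).le) hv (hf v)

omit [NeZero m] in
theorem PeaksAtCenter.re_lt_one {f : Mesh m .dual} (hf : PeaksAtCenter f) (v : Vertex m .dual) :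
    (f v).re < 1 :=
  (hf v).2 (by rcases v with _ | _ | _; simp [IsCenter])

theorem PeaksAtCenter.map_R {k : Kind} {f : Mesh m k} (hf : PeaksAtCenter f) :
    PeaksAtCenter (Op.R.map k f) := by
  intro x
  rw [Op.map_apply]
  refine ⟨average_re_le_one fun v => (hf v).1, fun hx => ?_⟩
  obtain ⟨v, hv, hvc⟩ := exists_mem_cell_not_isCenter (k := k) (not_isCenter_iff.1 hx)
  exact average_re_lt_one (fun v => (hf v).1) hv ((hf v).2 hvc)

omit [NeZero m] in
theorem site_ne_center {o : Op} (ho : o = .A ∨ o = .V) (x : Vertex m (o.out .primal)) :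
    o.site x ≠ center := by
  rcases ho with rfl | rfl
  · rcases x with _ | _ | ⟨l, i, j⟩
    simp [Op.site, faceSite, g]
  · rcases x with _ | _ | ⟨l, i, j⟩
    simp only [Op.site, edgeSite]
    split_ifs with h
    · simp [g]
    · rw [show i - j = i - j - 1 + 1 by omega]
      simp [g]

/-- The cells used by `A` and `V` are faces and edges, never the central vertex alone, so each
contains a vertex where the value is below one. `R`, in contrast, keeps the central vertex, which is
why a factor `A` or `V` is required. -/
theorem PeaksAtCenter.map_re_lt_one {k : Kind} {f : Mesh m k} (hf : PeaksAtCenter f) {o : Op}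
    (ho : o = .A ∨ o = .V) (x : Vertex m (o.out k)) : (o.map k f x).re < 1 := by
  rcases k with _ | _
  · rw [Op.map_apply]
    obtain ⟨v, hv, hvc⟩ := exists_mem_cell_not_isCenter (k := .primal) (site_ne_center ho x)
    exact average_re_lt_one (fun v => (hf v).1) hv ((hf v).2 hvc)
  · exact o.map_re_lt_one hf.re_lt_one x

theorem wordMap_re_lt_one (w : List Op) {k : Kind} {f : Mesh m k} (hf : ∀ v, (f v).re < 1)
    (x : Vertex m (outKind w k)) : (wordMap w k f x).re < 1 := by
  induction w generalizing k with
  | nil => exact hf x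
  | cons o w ih => exact ih (o.map_re_lt_one hf) x

theorem PeaksAtCenter.wordMap_re_lt_one {w : List Op} (hw : .A ∈ w ∨ .V ∈ w) {k : Kind}
    {f : Mesh m k} (hf : PeaksAtCenter f) (x : Vertex m (outKind w k)) :
    (wordMap w k f x).re < 1 := by
  induction w generalizing k with
  | nil => simp at hw
  | cons o w ih =>
    by_cases ho : o = .A ∨ o = .V
    · exact MidpointSubdivision.wordMap_re_lt_one w (fun v => hf.map_re_lt_one ho v) x
    · obtain rfl : o = .R := by cases o <;> simp at ho ⊢
      exact ih (by simpa using hw) hf.map_R x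

theorem subdivide_re_lt_one (e : Exponents) (k : Kind) (hk : e.Preserves k) (f : Mesh m k)
    (h : ∀ x, (wordMap e.word k f x).re < 1) (v : Vertex m k) : (subdivide e k hk f v).re < 1 := by
  have key : ∀ {k' : Kind} (h' : k' = k) (f' : Mesh m k'), (∀ x, (f' x).re < 1) →
      ∀ x, (LinearEquiv.cast (R := ℂ) (M := Mesh m) h' f' x).re < 1 := by
    rintro k' rfl f' hf'
    exact hf'
  exact key hk _ h _

theorem exists_mem_core_gridMesh_ne_zero {f : ℕ} (hφ : segmentAngle m f = Real.pi / 2)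
    (e : Exponents) (hav : 1 ≤ e.totalA + e.totalV) (k : Kind) (hk : e.Preserves k) :
    ∃ v ∈ core (m := m) e k hk, gridMesh f k v ≠ 0 := by
  classical
  have hU := isAveraging_subdivide (m := m) e k hk
  rcases k with _ | _
  · have hw : .A ∈ e.word ∨ .V ∈ e.word := by
      rw [e.mem_word_iff.1, e.mem_word_iff.2.1]
      omega
    -- The image of the indicator of the center is below 1 at the center. If nothing but the center
    -- influenced the center, it would agree there with the image of the constant mesh 1.
    have hpeak : PeaksAtCenter (Pi.single center 1 : Mesh m .primal) := by
      intro v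
      rw [not_isCenter_iff, Pi.single_apply]
      split_ifs with h <;> simp [h]
    have hlt := subdivide_re_lt_one e _ hk _ (hpeak.wordMap_re_lt_one hw) center
    obtain ⟨w, hw0, hw⟩ : ∃ w : Vertex m .primal, w ≠ center ∧
        subdivide e .primal hk (Pi.single w 1) center ≠ 0 := by
      by_contra! h
      rw [hU.congr (f := Pi.single center 1) (g := 1), hU.map_one] at hlt
      · simp at hlt
      · intro w hw
        by_cases hwc : w = center
        · subst hwc; simp
        · exact absurd (h w hwc) (by convert hw)
    exact ⟨w, mem_core (by simp [centralVertices, cell]) hw, gridMesh_primal_ne_zero hφ hw0⟩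
  · obtain ⟨v, hv⟩ := exists_mem_centralVertices (m := m) .dual
    obtain ⟨w, hw⟩ := hU.exists_ne_zero v
    exact ⟨w, mem_core hv (by convert hw), gridMesh_dual_ne_zero hφ w⟩

end CoreSize

/-! ### The eigenvalue of the grid mesh -/

theorem subdivide_pow_gridMesh {m f : ℕ} [NeZero m] (hφ : segmentAngle m f = Real.pi / 2)
    (e : Exponents) (hv : Even e.totalV) (k : Kind) (hk : e.Preserves k) (n : ℕ) :
    (subdivide e k hk ^ n) (gridMesh (m := m) f k) = (e.sigma : ℂ) ^ n • gridMesh f k := by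
  induction n with
  | zero => simp
  | succ n ih =>
    rw [pow_succ', Module.End.mul_apply, ih, map_smul, subdivide_gridMesh hφ e hv, smul_smul,
      pow_succ]

theorem isLambda_sigma {m f : ℕ} [NeZero m] (hφ : segmentAngle m f = Real.pi / 2)
    (e : Exponents) (hav : 1 ≤ e.totalA + e.totalV) (hv : Even e.totalV) (k : Kind)
    (hk : e.Preserves k) : IsLambda m e k hk f e.sigma := by
  have hσ : 0 < e.sigma := e.sigma_eq_wordScale ▸ wordScale_pos _
  refine ⟨hσ, fun N hN => ?_⟩
  obtain ⟨v, hvc, hv0⟩ := exists_mem_core_gridMesh_ne_zero hφ e hav k hk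
  set M : coreNet (m := m) e k hk 0 → ℂ := restrict _ (gridMesh f k) with hM
  have hM0 : M ≠ 0 := fun h => hv0 (congrFun h ⟨v, hvc⟩)
  have hNM : N M ≠ 0 := fun h => hM0 (hN _ h)
  refine ⟨(N M)⁻¹ • M, ?_, ⟨?_, ?_⟩, ?_, ?_⟩
  -- The grid mesh is an exact eigenmesh with σ > 0, so normalization removes σ^n and the sequence
  -- is constant.
  · refine tendsto_const_nhds.congr fun n => ?_
    have h1 : (fun v : coreNet (m := m) e k hk 0 =>
        (subdivide e k hk ^ n) (gridMesh f k) v.1) = e.sigma ^ n • M := by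
      funext v
      rw [subdivide_pow_gridMesh hφ e hv, Pi.smul_apply, Pi.smul_apply, hM, restrict_apply,
        Complex.real_smul, smul_eq_mul]
      push_cast
      rfl
    simp only [h1]
    rw [map_smul_eq_mul, Real.norm_of_nonneg (by positivity), smul_smul, mul_inv]
    congr 1
    field_simp
  · rintro v w hvw
    rw [Pi.smul_apply, Pi.smul_apply, hM, restrict_apply, restrict_apply, hvw, gridMesh_rot hφ,
      exp_segmentAngle hφ, Complex.real_smul, Complex.real_smul]
    ring
  · rintro v w hvw
    rw [Pi.smul_apply, Pi.smul_apply, hM, restrict_apply, restrict_apply, hvw,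
      gridMesh_reflect hφ, Complex.real_smul, Complex.real_smul, map_mul, Complex.conj_ofReal]
  · exact smul_ne_zero (inv_ne_zero hNM) hM0
  · rw [LinearMap.map_smul_of_tower, hM, subdivisionMatrix_restrict (isInvariant_core e hk),
      subdivide_gridMesh hφ e hv, map_smul, smul_comm]

/-! ### The operators on functions on the lattice `ℤ²` -/

section Lattice

def latR (f : ℤ → ℤ → ℂ) (x y : ℤ) : ℂ :=
  (f (x / 2) (y / 2) + f ((x + 1) / 2) (y / 2) + f (x / 2) ((y + 1) / 2) +
    f ((x + 1) / 2) ((y + 1) / 2)) / 4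

def latA (f : ℤ → ℤ → ℂ) (x y : ℤ) : ℂ :=
  (f x y + f (x + 1) y + f x (y + 1) + f (x + 1) (y + 1)) / 4

def latV (f : ℤ → ℤ → ℂ) (x y : ℤ) : ℂ := latR f (x + y + 1) (y - x)

def translate (a b : ℤ) (f : ℤ → ℤ → ℂ) (x y : ℤ) : ℂ := f (x + a) (y + b)

/-- A quarter turn around the point `(-a / 2, a / 2)`. -/
def turn (a : ℤ) (f : ℤ → ℤ → ℂ) (x y : ℤ) : ℂ := f (-y - a) x

/-- The halves in `latR` simplify only at arguments of visible parity. The differences of `latV` are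
therefore split by the parity of x + y + 1 and rewritten to positions 2i + c and 2j + d. -/
theorem latV_of_eq {f : ℤ → ℤ → ℂ} {x y p q : ℤ} (hp : x + y + 1 = p) (hq : y - x = q) :
    latV f x y = latR f p q := by
  subst hp hq
  rfl

/-! ### Second differences -/

def dxx (f : ℤ → ℤ → ℂ) (x y : ℤ) : ℂ := f (x + 2) y - 2 * f (x + 1) y + f x y

def dyy (f : ℤ → ℤ → ℂ) (x y : ℤ) : ℂ := f x (y + 2) - 2 * f x (y + 1) + f x y

def dxy (f : ℤ → ℤ → ℂ) (x y : ℤ) : ℂ := f (x + 1) (y + 1) - f (x + 1) y - f x (y + 1) + f x y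

/-- The mixed second difference in the two diagonal directions. -/
def ddiag (f : ℤ → ℤ → ℂ) (x y : ℤ) : ℂ :=
  f (x + 2) (y + 1) + f x (y + 1) - f (x + 1) (y + 2) - f (x + 1) y

variable (f : ℤ → ℤ → ℂ)

theorem ddiag_eq (x y : ℤ) : ddiag f x y = dxx f x (y + 1) - dyy f (x + 1) y := by
  simp only [ddiag, dxx, dyy]; ring

theorem dxx_latA (x y : ℤ) : dxx (latA f) x y =
    (dxx f x y + dxx f (x + 1) y + (dxx f x (y + 1) + dxx f (x + 1) (y + 1))) / 4 := by
  simp only [dxx, latA, add_assoc, Int.reduceAdd]; ring_nf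

theorem dyy_latA (x y : ℤ) : dyy (latA f) x y =
    (dyy f x y + dyy f x (y + 1) + (dyy f (x + 1) y + dyy f (x + 1) (y + 1))) / 4 := by
  simp only [dyy, latA, add_assoc, Int.reduceAdd]; ring_nf

theorem dxy_latA (x y : ℤ) : dxy (latA f) x y =
    (dxy f x y + dxy f (x + 1) y + (dxy f x (y + 1) + dxy f (x + 1) (y + 1))) / 4 := by
  simp only [dxy, latA, add_assoc, Int.reduceAdd]; ring_nf

theorem ddiag_latA (x y : ℤ) : ddiag (latA f) x y =
    (ddiag f x y + ddiag f (x + 1) y + (ddiag f x (y + 1) + ddiag f (x + 1) (y + 1))) / 4 := by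
  simp only [ddiag, latA, add_assoc, Int.reduceAdd]; ring_nf

theorem two_mul_ediv_two (i : ℤ) : 2 * i / 2 = i ∧ (2 * i + 1) / 2 = i ∧ (2 * i + 2) / 2 = i + 1 ∧
    (2 * i + 3) / 2 = i + 1 ∧ (2 * i + 4) / 2 = i + 2 ∧ (2 * i + 5) / 2 = i + 2 := by
  omega

/-- Refinement interpolates linearly between the lines at 2i and 2i + 2, so three consecutive points
starting at an even index are in arithmetic progression. -/
theorem dxx_latR_even (i y : ℤ) : dxx (latR f) (2 * i) y = 0 := by
  simp only [dxx, latR, add_assoc, Int.reduceAdd, two_mul_ediv_two]; ring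

theorem dxx_latR_odd (i y : ℤ) : dxx (latR f) (2 * i + 1) y =
    (dxx f i (y / 2) + dxx f i ((y + 1) / 2)) / 4 := by
  simp only [dxx, latR, add_assoc, Int.reduceAdd, two_mul_ediv_two]; ring

theorem dyy_latR_even (x j : ℤ) : dyy (latR f) x (2 * j) = 0 := by
  simp only [dyy, latR, add_assoc, Int.reduceAdd, two_mul_ediv_two]; ring

theorem dyy_latR_odd (x j : ℤ) : dyy (latR f) x (2 * j + 1) =
    (dyy f (x / 2) j + dyy f ((x + 1) / 2) j) / 4 := by
  simp only [dyy, latR, add_assoc, Int.reduceAdd, two_mul_ediv_two]; ring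

/-- A refined unit cell lies inside one old cell, on which the refined function is sampled from the
bilinear interpolant; its mixed difference is quartered. -/
theorem dxy_latR (x y : ℤ) : dxy (latR f) x y = dxy f (x / 2) (y / 2) / 4 := by
  obtain ⟨i, rfl | rfl⟩ := Int.even_or_odd' x <;> obtain ⟨j, rfl | rfl⟩ := Int.even_or_odd' y <;>
    simp only [dxy, latR, add_assoc, Int.reduceAdd, two_mul_ediv_two] <;> ring

theorem ddiag_latR_odd_odd (i j : ℤ) :
    ddiag (latR f) (2 * i + 1) (2 * j + 1) = ddiag f i j / 2 := by
  simp only [ddiag, latR, add_assoc, Int.reduceAdd, two_mul_ediv_two]; ring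

theorem dxx_latV_odd {x y i j : ℤ} (hp : x + y + 1 = 2 * i + 1) (hq : y - x = 2 * j + 2) :
    dxx (latV f) x y =
      ((dxx f i j + dxx f i (j + 1)) - (dxy f i j + dxy f (i + 1) j)) / 4 := by
  rw [dxx, latV_of_eq (p := 2 * i + 3) (q := 2 * j) (by omega) (by omega),
    latV_of_eq (p := 2 * i + 2) (q := 2 * j + 1) (by omega) (by omega),
    latV_of_eq (p := 2 * i + 1) (q := 2 * j + 2) (by omega) (by omega)]
  simp only [dxx, dxy, latR, add_assoc, Int.reduceAdd, two_mul_ediv_two]; ring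

theorem dxx_latV_even {x y i j : ℤ} (hp : x + y + 1 = 2 * i) (hq : y - x = 2 * j + 3) :
    dxx (latV f) x y =
      ((dyy f i j + dyy f (i + 1) j) - (dxy f i j + dxy f i (j + 1))) / 4 := by
  rw [dxx, latV_of_eq (p := 2 * i + 2) (q := 2 * j + 1) (by omega) (by omega),
    latV_of_eq (p := 2 * i + 1) (q := 2 * j + 2) (by omega) (by omega),
    latV_of_eq (p := 2 * i) (q := 2 * j + 3) (by omega) (by omega)]
  simp only [dyy, dxy, latR, add_assoc, Int.reduceAdd, two_mul_ediv_two]; ring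

theorem dyy_latV_odd {x y i j : ℤ} (hp : x + y + 1 = 2 * i + 1) (hq : y - x = 2 * j) :
    dyy (latV f) x y =
      ((dxx f i j + dxx f i (j + 1)) + (dxy f i j + dxy f (i + 1) j)) / 4 := by
  rw [dyy, latV_of_eq (p := 2 * i + 3) (q := 2 * j + 2) (by omega) (by omega),
    latV_of_eq (p := 2 * i + 2) (q := 2 * j + 1) (by omega) (by omega),
    latV_of_eq (p := 2 * i + 1) (q := 2 * j) (by omega) (by omega)]
  simp only [dxx, dxy, latR, add_assoc, Int.reduceAdd, two_mul_ediv_two]; ring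

theorem dyy_latV_even {x y i j : ℤ} (hp : x + y + 1 = 2 * i) (hq : y - x = 2 * j + 1) :
    dyy (latV f) x y =
      ((dyy f i j + dyy f (i + 1) j) + (dxy f i j + dxy f i (j + 1))) / 4 := by
  rw [dyy, latV_of_eq (p := 2 * i + 2) (q := 2 * j + 3) (by omega) (by omega),
    latV_of_eq (p := 2 * i + 1) (q := 2 * j + 2) (by omega) (by omega),
    latV_of_eq (p := 2 * i) (q := 2 * j + 1) (by omega) (by omega)]
  simp only [dyy, dxy, latR, add_assoc, Int.reduceAdd, two_mul_ediv_two]; ring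

/-- The four points are the midpoints of the edges at one old vertex. Because `V` turns by 45
degrees, mixed and diagonal differences exchange their roles. -/
theorem dxy_latV_odd {x y i j : ℤ} (hp : x + y + 1 = 2 * i + 1) (hq : y - x = 2 * j + 2) :
    dxy (latV f) x y = ddiag f i j / 2 := by
  rw [dxy, latV_of_eq (p := 2 * i + 3) (q := 2 * j + 2) (by omega) (by omega),
    latV_of_eq (p := 2 * i + 2) (q := 2 * j + 1) (by omega) (by omega),
    latV_of_eq (p := 2 * i + 2) (q := 2 * j + 3) (by omega) (by omega),
    latV_of_eq (p := 2 * i + 1) (q := 2 * j + 2) (by omega) (by omega)]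
  simp only [ddiag, latR, add_assoc, Int.reduceAdd, two_mul_ediv_two]; ring

/-- The four points are the edge midpoints of one old face, and these form a parallelogram
(Varignon). -/
theorem dxy_latV_even {x y i j : ℤ} (hp : x + y + 1 = 2 * i) (hq : y - x = 2 * j + 1) :
    dxy (latV f) x y = 0 := by
  rw [dxy, latV_of_eq (p := 2 * i + 2) (q := 2 * j + 1) (by omega) (by omega),
    latV_of_eq (p := 2 * i + 1) (q := 2 * j) (by omega) (by omega),
    latV_of_eq (p := 2 * i + 1) (q := 2 * j + 2) (by omega) (by omega),
    latV_of_eq (p := 2 * i) (q := 2 * j + 1) (by omega) (by omega)]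
  simp only [latR, add_assoc, Int.reduceAdd, two_mul_ediv_two]; ring

theorem ddiag_latV_odd {x y i j : ℤ} (hp : x + y + 1 = 2 * i + 1) (hq : y - x = 2 * j + 2) :
    ddiag (latV f) x y = -(dxy f (i + 1) j + dxy f (i + 1) (j + 1)) / 2 := by
  rw [ddiag, latV_of_eq (p := 2 * i + 4) (q := 2 * j + 1) (by omega) (by omega),
    latV_of_eq (p := 2 * i + 2) (q := 2 * j + 3) (by omega) (by omega),
    latV_of_eq (p := 2 * i + 4) (q := 2 * j + 3) (by omega) (by omega),
    latV_of_eq (p := 2 * i + 2) (q := 2 * j + 1) (by omega) (by omega)]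
  simp only [dxy, latR, add_assoc, Int.reduceAdd, two_mul_ediv_two]; ring

theorem ddiag_latV_even {x y i j : ℤ} (hp : x + y + 1 = 2 * i) (hq : y - x = 2 * j + 1) :
    ddiag (latV f) x y = -(dxy f i j + dxy f (i + 1) j) / 2 := by
  rw [ddiag, latV_of_eq (p := 2 * i + 3) (q := 2 * j) (by omega) (by omega),
    latV_of_eq (p := 2 * i + 1) (q := 2 * j + 2) (by omega) (by omega),
    latV_of_eq (p := 2 * i + 3) (q := 2 * j + 2) (by omega) (by omega),
    latV_of_eq (p := 2 * i + 1) (q := 2 * j) (by omega) (by omega)]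
  simp only [dxy, latR, add_assoc, Int.reduceAdd, two_mul_ediv_two]; ring

end Lattice

/-! ### Bounds for second differences -/

section Bounds

theorem norm_add_div_four_le {a b : ℂ} {s t : ℝ} (ha : ‖a‖ ≤ s) (hb : ‖b‖ ≤ t) :
    ‖(a + b) / 4‖ ≤ (s + t) / 4 := by
  rw [norm_div, Complex.norm_ofNat]
  gcongr
  exact (norm_add_le a b).trans (add_le_add ha hb)

theorem norm_sub_div_four_le {a b : ℂ} {s t : ℝ} (ha : ‖a‖ ≤ s) (hb : ‖b‖ ≤ t) :
    ‖(a - b) / 4‖ ≤ (s + t) / 4 := by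
  rw [sub_eq_add_neg]
  exact norm_add_div_four_le ha (by rwa [norm_neg])

theorem norm_div_le {a b : ℂ} {s t : ℝ} (ha : ‖a‖ ≤ s) (hb : ‖b‖ = t) (ht : 0 < t) :
    ‖a / b‖ ≤ s / t := by
  rw [norm_div, hb]
  gcongr

/-- Bounds for second differences that are improved by a factor less than `2 ^ (-1 / 2)` under the
mid-edge operator. -/
structure DiagBound (c : ℝ) (f : ℤ → ℤ → ℂ) : Prop where
  xx : ∀ x y, ‖dxx f x y‖ ≤ c
  yy : ∀ x y, ‖dyy f x y‖ ≤ c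
  diag : ∀ x y, ‖ddiag f x y‖ ≤ c
  xy : ∀ x y, ‖dxy f x y‖ ≤ 4 / 5 * c
  xy_x : ∀ x y, ‖dxy f x y + dxy f (x + 1) y‖ ≤ 4 / 5 * c
  xy_y : ∀ x y, ‖dxy f x y + dxy f x (y + 1)‖ ≤ 4 / 5 * c

/-- Bounds for second differences that are improved under refinement and averaging. -/
structure AxisBound (c t : ℝ) (f : ℤ → ℤ → ℂ) : Prop where
  xx : ∀ x y, ‖dxx f x y‖ ≤ c
  yy : ∀ x y, ‖dyy f x y‖ ≤ c
  xy : ∀ x y, ‖dxy f x y‖ ≤ t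
  xx_x : ∀ x y, ‖dxx f x y + dxx f (x + 1) y‖ ≤ 2 * t
  yy_y : ∀ x y, ‖dyy f x y + dyy f x (y + 1)‖ ≤ 2 * t

variable {c t : ℝ} {f : ℤ → ℤ → ℂ}

theorem DiagBound.nonneg (h : DiagBound c f) : 0 ≤ c := (norm_nonneg _).trans (h.xx 0 0)

/-! ### Diagonal bounds under averaging, refinement, mid-edges and symmetries -/

theorem DiagBound.latA (h : DiagBound c f) : DiagBound c (latA f) where
  xx x y := by
    rw [dxx_latA]
    have := norm_add_div_four_le (norm_add_le_of_le (h.xx x y) (h.xx (x + 1) y))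
      (norm_add_le_of_le (h.xx x (y + 1)) (h.xx (x + 1) (y + 1)))
    linarith
  yy x y := by
    rw [dyy_latA]
    have := norm_add_div_four_le (norm_add_le_of_le (h.yy x y) (h.yy x (y + 1)))
      (norm_add_le_of_le (h.yy (x + 1) y) (h.yy (x + 1) (y + 1)))
    linarith
  diag x y := by
    rw [ddiag_latA]
    have := norm_add_div_four_le (norm_add_le_of_le (h.diag x y) (h.diag (x + 1) y))
      (norm_add_le_of_le (h.diag x (y + 1)) (h.diag (x + 1) (y + 1)))
    linarith
  xy x y := by
    rw [dxy_latA]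
    have := norm_add_div_four_le (h.xy_x x y) (h.xy_x x (y + 1))
    linarith [h.nonneg]
  xy_x x y := by
    rw [dxy_latA, dxy_latA]
    have h1 := norm_add_div_four_le (h.xy_x x y) (h.xy_x x (y + 1))
    have h2 := norm_add_div_four_le (h.xy_x (x + 1) y) (h.xy_x (x + 1) (y + 1))
    exact (norm_add_le_of_le h1 h2).trans (by linarith)
  xy_y x y := by
    rw [dxy_latA, dxy_latA]
    have h1 := norm_add_div_four_le (h.xy_x x y) (h.xy_x x (y + 1))
    have h2 := norm_add_div_four_le (h.xy_x x (y + 1)) (h.xy_x x (y + 1 + 1))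
    exact (norm_add_le_of_le h1 h2).trans (by linarith)

theorem norm_dxx_latR_le (h : ∀ x y, ‖dxx f x y‖ ≤ c) (x y : ℤ) :
    ‖dxx (latR f) x y‖ ≤ c / 2 := by
  have hc := (norm_nonneg _).trans (h 0 0)
  obtain ⟨i, rfl | rfl⟩ := Int.even_or_odd' x
  · rw [dxx_latR_even, norm_zero]
    linarith
  · rw [dxx_latR_odd]
    have := norm_add_div_four_le (h i (y / 2)) (h i ((y + 1) / 2))
    linarith

theorem norm_dyy_latR_le (h : ∀ x y, ‖dyy f x y‖ ≤ c) (x y : ℤ) :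
    ‖dyy (latR f) x y‖ ≤ c / 2 := by
  have hc := (norm_nonneg _).trans (h 0 0)
  obtain ⟨j, rfl | rfl⟩ := Int.even_or_odd' y
  · rw [dyy_latR_even, norm_zero]
    linarith
  · rw [dyy_latR_odd]
    have := norm_add_div_four_le (h (x / 2) j) (h ((x + 1) / 2) j)
    linarith

theorem norm_dxy_latR_le (h : ∀ x y, ‖dxy f x y‖ ≤ c) (x y : ℤ) :
    ‖dxy (latR f) x y‖ ≤ c / 4 := by
  rw [dxy_latR]
  exact norm_div_le (h _ _) (Complex.norm_ofNat 4) four_pos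

theorem DiagBound.latR (h : DiagBound c f) : DiagBound (c / 2) (latR f) where
  xx := norm_dxx_latR_le h.xx
  yy := norm_dyy_latR_le h.yy
  diag x y := by
    have hc := h.nonneg
    -- As a difference of `dxx` and `dyy` alone, the diagonal difference would only be bounded by c.
    -- If a coordinate is even, one of the two vanishes; if both are odd, the diagonal difference
    -- itself is halved.
    obtain ⟨i, rfl | rfl⟩ := Int.even_or_odd' x <;> obtain ⟨j, rfl | rfl⟩ := Int.even_or_odd' y
    · rw [ddiag_eq, dxx_latR_even, zero_sub, norm_neg]
      exact norm_dyy_latR_le h.yy _ _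
    · rw [ddiag_eq, dxx_latR_even, zero_sub, norm_neg]
      exact norm_dyy_latR_le h.yy _ _
    · rw [ddiag_eq, dyy_latR_even, sub_zero]
      exact norm_dxx_latR_le h.xx _ _
    · rw [ddiag_latR_odd_odd]
      exact norm_div_le (h.diag _ _) (Complex.norm_ofNat 2) two_pos
  xy x y := by
    have hc := h.nonneg
    exact (norm_dxy_latR_le h.xy x y).trans (by linarith)
  xy_x x y :=
    (norm_add_le_of_le (norm_dxy_latR_le h.xy x y) (norm_dxy_latR_le h.xy (x + 1) y)).trans
      (by linarith)
  xy_y x y :=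
    (norm_add_le_of_le (norm_dxy_latR_le h.xy x y) (norm_dxy_latR_le h.xy x (y + 1))).trans
      (by linarith)

theorem norm_dxy_latV_le (h : ∀ x y, ‖ddiag f x y‖ ≤ c) (x y : ℤ) :
    ‖dxy (latV f) x y‖ ≤ c / 2 := by
  have hc := (norm_nonneg _).trans (h 0 0)
  obtain ⟨i, hi | hi⟩ := Int.even_or_odd' (x + y + 1)
  · rw [dxy_latV_even f hi (j := i - x - 1) (by omega), norm_zero]
    linarith
  · rw [dxy_latV_odd f hi (j := i - x - 1) (by omega)]
    exact norm_div_le (h _ _) (Complex.norm_ofNat 2) two_pos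

/-- With weight α in place of 4/5, the pure differences shrink by (2 + α)/4 and the mixed ones
require a rate of at least 1/(2α). Both are below 2^(-1/2) exactly for 2^(-1/2) < α < 2√2 - 2, and α
= 4/5 gives 7/10. Sums of neighbouring mixed differences obey the same bound as single ones because
one of two neighbours always vanishes. -/
theorem DiagBound.latV (h : DiagBound c f) : DiagBound (7 / 10 * c) (latV f) where
  xx x y := by
    obtain ⟨i, hi | hi⟩ := Int.even_or_odd' (x + y + 1)
    · rw [dxx_latV_even f hi (j := i - x - 2) (by omega)]
      exact (norm_sub_div_four_le (norm_add_le_of_le (h.yy _ _) (h.yy _ _)) (h.xy_y _ _)).trans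
        (by linarith)
    · rw [dxx_latV_odd f hi (j := i - x - 1) (by omega)]
      exact (norm_sub_div_four_le (norm_add_le_of_le (h.xx _ _) (h.xx _ _)) (h.xy_x _ _)).trans
        (by linarith)
  yy x y := by
    obtain ⟨i, hi | hi⟩ := Int.even_or_odd' (x + y + 1)
    · rw [dyy_latV_even f hi (j := i - x - 1) (by omega)]
      exact (norm_add_div_four_le (norm_add_le_of_le (h.yy _ _) (h.yy _ _)) (h.xy_y _ _)).trans
        (by linarith)
    · rw [dyy_latV_odd f hi (j := i - x) (by omega)]
      exact (norm_add_div_four_le (norm_add_le_of_le (h.xx _ _) (h.xx _ _)) (h.xy_x _ _)).trans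
        (by linarith)
  diag x y := by
    have hc := h.nonneg
    obtain ⟨i, hi | hi⟩ := Int.even_or_odd' (x + y + 1)
    · rw [ddiag_latV_even f hi (j := i - x - 1) (by omega)]
      rw [neg_div, norm_neg]
      exact (norm_div_le (h.xy_x _ _) (Complex.norm_ofNat 2) two_pos).trans (by linarith)
    · rw [ddiag_latV_odd f hi (j := i - x - 1) (by omega)]
      rw [neg_div, norm_neg]
      exact (norm_div_le (h.xy_y _ _) (Complex.norm_ofNat 2) two_pos).trans (by linarith)
  xy x y := by
    have hc := h.nonneg
    exact (norm_dxy_latV_le h.diag x y).trans (by linarith)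
  xy_x x y := by
    have hc := h.nonneg
    obtain ⟨i, hi | hi⟩ := Int.even_or_odd' (x + y + 1)
    · rw [dxy_latV_even f hi (j := i - x - 1) (by omega), zero_add]
      exact (norm_dxy_latV_le h.diag _ _).trans (by linarith)
    · rw [dxy_latV_even f (x := x + 1) (i := i + 1) (j := i - x - 1) (by omega) (by omega), add_zero]
      exact (norm_dxy_latV_le h.diag _ _).trans (by linarith)
  xy_y x y := by
    have hc := h.nonneg
    obtain ⟨i, hi | hi⟩ := Int.even_or_odd' (x + y + 1)
    · rw [dxy_latV_even f hi (j := i - x - 1) (by omega), zero_add]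
      exact (norm_dxy_latV_le h.diag _ _).trans (by linarith)
    · rw [dxy_latV_even f (y := y + 1) (i := i + 1) (j := i - x) (by omega) (by omega), add_zero]
      exact (norm_dxy_latV_le h.diag _ _).trans (by linarith)

theorem DiagBound.translate (h : DiagBound c f) (a b : ℤ) : DiagBound c (translate a b f) where
  xx x y := by
    convert h.xx (x + a) (y + b) using 2
    simp only [dxx, MidpointSubdivision.translate, add_right_comm]
  yy x y := by
    convert h.yy (x + a) (y + b) using 2
    simp only [dyy, MidpointSubdivision.translate, add_right_comm]
  diag x y := by
    convert h.diag (x + a) (y + b) using 2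
    simp only [ddiag, MidpointSubdivision.translate, add_right_comm]
  xy x y := by
    convert h.xy (x + a) (y + b) using 2
    simp only [dxy, MidpointSubdivision.translate, add_right_comm]
  xy_x x y := by
    convert h.xy_x (x + a) (y + b) using 2
    simp only [dxy, MidpointSubdivision.translate, add_right_comm _ a]
    ring_nf
  xy_y x y := by
    convert h.xy_y (x + a) (y + b) using 2
    simp only [dxy, MidpointSubdivision.translate, add_right_comm _ b]
    ring_nf

theorem dxy_turn (a : ℤ) (f : ℤ → ℤ → ℂ) (x y : ℤ) :
    dxy (turn a f) x y = -dxy f (-y - 1 - a) x := by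
  simp only [dxy, turn]
  ring_nf

theorem dxx_turn (a : ℤ) (f : ℤ → ℤ → ℂ) (x y : ℤ) :
    dxx (turn a f) x y = dyy f (-y - a) x := rfl

theorem dyy_turn (a : ℤ) (f : ℤ → ℤ → ℂ) (x y : ℤ) :
    dyy (turn a f) x y = dxx f (-y - 2 - a) x := by
  simp only [dxx, dyy, turn]
  ring_nf

theorem ddiag_turn (a : ℤ) (f : ℤ → ℤ → ℂ) (x y : ℤ) :
    ddiag (turn a f) x y = -ddiag f (-y - 2 - a) x := by
  simp only [ddiag, turn]
  ring_nf

theorem DiagBound.turn (h : DiagBound c f) (a : ℤ) : DiagBound c (turn a f) where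
  xx x y := by
    rw [dxx_turn]
    exact h.yy _ _
  yy x y := by
    rw [dyy_turn]
    exact h.xx _ _
  diag x y := by
    rw [ddiag_turn, norm_neg]
    exact h.diag _ _
  xy x y := by
    rw [dxy_turn, norm_neg]
    exact h.xy _ _
  xy_x x y := by
    rw [dxy_turn, dxy_turn, ← neg_add, norm_neg]
    exact h.xy_y _ _
  xy_y x y := by
    rw [dxy_turn, dxy_turn, ← neg_add, norm_neg, add_comm,
      show -y - 1 - a = -(y + 1) - 1 - a + 1 by ring]
    exact h.xy_x _ _

/-! ### Axis bounds under averaging, refinement and translation -/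

theorem AxisBound.latA (h : AxisBound c t f) : AxisBound t t (latA f) where
  xx x y := by
    rw [dxx_latA]
    exact (norm_add_div_four_le (h.xx_x x y) (h.xx_x x (y + 1))).trans (by linarith)
  yy x y := by
    rw [dyy_latA]
    exact (norm_add_div_four_le (h.yy_y x y) (h.yy_y (x + 1) y)).trans (by linarith)
  xy x y := by
    rw [dxy_latA]
    exact (norm_add_div_four_le (norm_add_le_of_le (h.xy _ _) (h.xy _ _))
      (norm_add_le_of_le (h.xy _ _) (h.xy _ _))).trans (by linarith)
  xx_x x y := by
    rw [dxx_latA, dxx_latA]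
    exact (norm_add_le_of_le (norm_add_div_four_le (h.xx_x _ _) (h.xx_x _ _))
      (norm_add_div_four_le (h.xx_x _ _) (h.xx_x _ _))).trans (by linarith)
  yy_y x y := by
    rw [dyy_latA, dyy_latA]
    exact (norm_add_le_of_le (norm_add_div_four_le (h.yy_y _ _) (h.yy_y _ _))
      (norm_add_div_four_le (h.yy_y _ _) (h.yy_y _ _))).trans (by linarith)

/-- Single pure differences only halve, which is no better than the scaling factor of `R`. The gain
is that every second one is zero, so the sum of two neighbours is also at most c/2; a later `A`,
which averages neighbours, turns this into an improved bound on single differences. -/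
theorem AxisBound.latR (h : AxisBound c t f) (ht : t ≤ c) :
    AxisBound (c / 2) (c / 4) (latR f) where
  xx := norm_dxx_latR_le h.xx
  yy := norm_dyy_latR_le h.yy
  xy x y := (norm_dxy_latR_le h.xy x y).trans (by linarith)
  xx_x x y := by
    obtain ⟨i, rfl | rfl⟩ := Int.even_or_odd' x
    · rw [dxx_latR_even, zero_add]
      exact (norm_dxx_latR_le h.xx _ _).trans (by linarith)
    · rw [show 2 * i + 1 + 1 = 2 * (i + 1) by ring, dxx_latR_even, add_zero]
      exact (norm_dxx_latR_le h.xx _ _).trans (by linarith)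
  yy_y x y := by
    obtain ⟨j, rfl | rfl⟩ := Int.even_or_odd' y
    · rw [dyy_latR_even, zero_add]
      exact (norm_dyy_latR_le h.yy _ _).trans (by linarith)
    · rw [show 2 * j + 1 + 1 = 2 * (j + 1) by ring, dyy_latR_even, add_zero]
      exact (norm_dyy_latR_le h.yy _ _).trans (by linarith)

theorem AxisBound.translate (h : AxisBound c t f) (a b : ℤ) :
    AxisBound c t (translate a b f) where
  xx x y := by
    convert h.xx (x + a) (y + b) using 2
    simp only [dxx, MidpointSubdivision.translate, add_right_comm]
  yy x y := by
    convert h.yy (x + a) (y + b) using 2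
    simp only [dyy, MidpointSubdivision.translate, add_right_comm]
  xy x y := by
    convert h.xy (x + a) (y + b) using 2
    simp only [dxy, MidpointSubdivision.translate, add_right_comm]
  xx_x x y := by
    convert h.xx_x (x + a) (y + b) using 2
    simp only [dxx, MidpointSubdivision.translate, add_right_comm _ a]
  yy_y x y := by
    convert h.yy_y (x + a) (y + b) using 2
    simp only [dyy, MidpointSubdivision.translate, add_right_comm _ b]

end Bounds

/-! ### The ringnets of valence four as lattices -/

section Position

/-- The point with coordinates `x`, `y` in the `l`-th quadrant. -/
def quarter (l : ZMod 4) (x y : ℤ) : ℤ × ℤ :=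
  match (l : Fin 4) with
  | 0 => (x, y)
  | 1 => (-y, x)
  | 2 => (-x, -y)
  | 3 => (y, -x)

/-- The lower left corner of the unit cell at `(i, j)` in the `l`-th quadrant. -/
def quarterCell (l : ZMod 4) (i j : ℤ) : ℤ × ℤ :=
  match (l : Fin 4) with
  | 0 => (i, j)
  | 1 => (-j - 1, i)
  | 2 => (-i - 1, -j - 1)
  | 3 => (j, -i - 1)

/-- The position of a vertex of a ringnet of valence four in `ℤ²`; the dual vertices are moved by
`(-1 / 2, -1 / 2)`. -/
def pos : {k : Kind} → Vertex 4 k → ℤ × ℤ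
  | _, center => (0, 0)
  | _, pv l i j => quarter l (i + 1) j
  | _, dv l i j => quarterCell l i j

theorem pos_center : pos (center : Vertex 4 .primal) = (0, 0) := rfl

theorem pos_pv (l : ZMod 4) (i j : ℕ) : pos (pv l i j) = quarter l (i + 1) j := rfl

theorem pos_dv (l : ZMod 4) (i j : ℕ) : pos (dv l i j) = quarterCell l i j := rfl

/-- Twice the offset of the true coordinates from the integer coordinates `pos`. -/
def Kind.shift : Kind → ℤ
  | .primal => 0
  | .dual => 1

theorem zmod_four_cases (l : ZMod 4) : l = 0 ∨ l = 1 ∨ l = 2 ∨ l = 3 := by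
  revert l
  decide

theorem quarter_add_one (l : ZMod 4) (x y : ℤ) : quarter (l + 1) x y = quarter l (-y) x := by
  rcases zmod_four_cases l with rfl | rfl | rfl | rfl
  · rfl
  · rfl
  · change (y, -x) = (- -y, -x)
    rw [neg_neg]
  · change (x, y) = (x, - -y)
    rw [neg_neg]

theorem quarter_sub_one (l : ZMod 4) (x y : ℤ) : quarter (l - 1) x y = quarter l y (-x) := by
  have := quarter_add_one (l - 1) y (-x)
  rw [sub_add_cancel, neg_neg] at this
  exact this.symm

theorem quarterCell_add_one (l : ZMod 4) (i j : ℤ) :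
    quarterCell (l + 1) i j = quarterCell l (-j - 1) i := by
  rcases zmod_four_cases l with rfl | rfl | rfl | rfl
  · rfl
  · rfl
  · exact Prod.ext (by change j = -(-j - 1) - 1; ring) rfl
  · exact Prod.ext rfl (by change j = -(-j - 1) - 1; ring)

theorem pos_g (l : ZMod 4) (i j : ℕ) : pos (g l i j) = quarter l i j := by
  rcases i with _ | i
  · rcases j with _ | j
    · rcases zmod_four_cases l with rfl | rfl | rfl | rfl <;> rfl
    · simp only [g, pos, quarter_add_one]
      rcases zmod_four_cases l with rfl | rfl | rfl | rfl <;> simp [quarter]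
  · simp only [g, pos]
    push_cast
    rfl

theorem quarter_zero (x y : ℤ) : quarter 0 x y = (x, y) := rfl
theorem quarter_one (x y : ℤ) : quarter 1 x y = (-y, x) := rfl
theorem quarter_two (x y : ℤ) : quarter 2 x y = (-x, -y) := rfl
theorem quarter_three (x y : ℤ) : quarter 3 x y = (y, -x) := rfl
theorem quarterCell_zero (i j : ℤ) : quarterCell 0 i j = (i, j) := rfl
theorem quarterCell_one (i j : ℤ) : quarterCell 1 i j = (-j - 1, i) := rfl
theorem quarterCell_two (i j : ℤ) : quarterCell 2 i j = (-i - 1, -j - 1) := rfl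
theorem quarterCell_three (i j : ℤ) : quarterCell 3 i j = (j, -i - 1) := rfl

theorem pos_injective (k : Kind) : Function.Injective (pos (k := k)) := by
  intro v w h
  rcases v with _ | ⟨l, i, j⟩ | ⟨l, i, j⟩ <;> rcases w with _ | ⟨l', i', j'⟩ | ⟨l', i', j'⟩
  · rfl
  · rcases zmod_four_cases l' with rfl | rfl | rfl | rfl <;>
      simp only [pos_center, pos_pv, quarter_zero, quarter_one, quarter_two, quarter_three, Prod.mk.injEq] at h <;>
      omega
  · rcases zmod_four_cases l with rfl | rfl | rfl | rfl <;>
      simp only [pos_center, pos_pv, quarter_zero, quarter_one, quarter_two, quarter_three, Prod.mk.injEq] at h <;>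
      omega
  · rcases zmod_four_cases l with rfl | rfl | rfl | rfl <;>
      rcases zmod_four_cases l' with rfl | rfl | rfl | rfl <;>
      simp only [pos_pv, quarter_zero, quarter_one, quarter_two, quarter_three, Prod.mk.injEq] at h <;>
      first
      | omega
      | (obtain ⟨rfl, rfl⟩ : i = i' ∧ j = j' := by omega
         rfl)
  · rcases zmod_four_cases l with rfl | rfl | rfl | rfl <;>
      rcases zmod_four_cases l' with rfl | rfl | rfl | rfl <;>
      simp only [pos_dv, quarterCell_zero, quarterCell_one, quarterCell_two, quarterCell_three,
        Prod.mk.injEq] at h <;>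
      first
      | omega
      | (obtain ⟨rfl, rfl⟩ : i = i' ∧ j = j' := by omega
         rfl)

theorem pos_surjective (k : Kind) : Function.Surjective (pos (k := k)) := by
  rintro ⟨x, y⟩
  rcases k with _ | _
  · by_cases h0 : x = 0 ∧ y = 0
    · exact ⟨center, by rw [h0.1, h0.2]; rfl⟩
    by_cases h1 : 0 < x ∧ 0 ≤ y
    · refine ⟨pv 0 (x - 1).toNat y.toNat, ?_⟩
      simp only [pos_pv, quarter_zero, Prod.mk.injEq]
      omega
    by_cases h2 : x ≤ 0 ∧ 0 < y
    · refine ⟨pv 1 (y - 1).toNat (-x).toNat, ?_⟩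
      simp only [pos_pv, quarter_one, Prod.mk.injEq]
      omega
    by_cases h3 : x < 0 ∧ y ≤ 0
    · refine ⟨pv 2 (-x - 1).toNat (-y).toNat, ?_⟩
      simp only [pos_pv, quarter_two, Prod.mk.injEq]
      omega
    · refine ⟨pv 3 (-y - 1).toNat x.toNat, ?_⟩
      simp only [pos_pv, quarter_three, Prod.mk.injEq]
      omega
  · by_cases h1 : 0 ≤ x ∧ 0 ≤ y
    · refine ⟨dv 0 x.toNat y.toNat, ?_⟩
      simp only [pos_dv, quarterCell_zero, Prod.mk.injEq]
      omega
    by_cases h2 : x < 0 ∧ 0 ≤ y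
    · refine ⟨dv 1 y.toNat (-x - 1).toNat, ?_⟩
      simp only [pos_dv, quarterCell_one, Prod.mk.injEq]
      omega
    by_cases h3 : x < 0 ∧ y < 0
    · refine ⟨dv 2 (-x - 1).toNat (-y - 1).toNat, ?_⟩
      simp only [pos_dv, quarterCell_two, Prod.mk.injEq]
      omega
    · refine ⟨dv 3 (-y - 1).toNat x.toNat, ?_⟩
      simp only [pos_dv, quarterCell_three, Prod.mk.injEq]
      omega

/-- The mesh with the values of a function on the lattice. -/
def pull {k : Kind} (F : ℤ → ℤ → ℂ) : Mesh 4 k := fun v => F (pos v).1 (pos v).2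

/-- In valence four the central element is regular, so all cells follow one formula. Changing the
sign of a coordinate exchanges floor and ceiling of its half, which only permutes the four terms. -/
theorem average_cell_pull {k : Kind} (x : Vertex 4 .primal) (F : ℤ → ℤ → ℂ) :
    average (cell x) (pull F : Mesh 4 k) = latR F ((pos x).1 - k.shift) ((pos x).2 - k.shift) := by
  rcases k with _ | _ <;> rcases x with _ | ⟨l, i, j⟩
  · simp only [cell, average_singleton, pull, pos_center, Kind.shift, latR]
    norm_num
    ring
  · simp only [cell, average_four, pull, pos_pv, pos_g, Kind.shift, sub_zero, latR]
    have h1 : (-(i + 1) : ℤ) / 2 = -((i + 1 + 1) / 2) := by omega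
    have h2 : (-(i + 1) + 1 : ℤ) / 2 = -((i + 1) / 2) := by omega
    have h3 : (-j : ℤ) / 2 = -((j + 1) / 2) := by omega
    have h4 : (-j + 1 : ℤ) / 2 = -(j / 2) := by omega
    rcases zmod_four_cases l with rfl | rfl | rfl | rfl <;>
      simp only [quarter_zero, quarter_one, quarter_two, quarter_three, h1, h2, h3, h4] <;>
      push_cast <;> ring
  · rw [average_apply]
    simp only [cell, Multiset.map_map, Function.comp_def, pull, pos_center, pos_dv, Kind.shift, latR]
    have : (Multiset.map (fun l : ZMod 4 => F (quarterCell l (0 : ℕ) (0 : ℕ)).1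
        (quarterCell l (0 : ℕ) (0 : ℕ)).2) Finset.univ.val).sum =
        F 0 0 + F (-1) 0 + F (-1) (-1) + F 0 (-1) := by
      change ∑ l : Fin 4, _ = _
      rw [Fin.sum_univ_four]
      rfl
    rw [this]
    simp
    ring
  · rcases j with _ | j
    · simp only [cell, average_four, pull, pos_pv, pos_dv, Kind.shift, latR]
      have h0 (l : ZMod 4) (a b : ℤ) : quarterCell (l - 1) a b = quarterCell l b (-a - 1) := by
        have := quarterCell_add_one (l - 1) b (-a - 1)
        rw [sub_add_cancel] at this
        rw [this]
        congr 1
        ring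
      have h1 : (-(i + 1) - 1 : ℤ) / 2 = -((i + 1) / 2) - 1 := by omega
      have h2 : (-(i + 1) - 1 + 1 : ℤ) / 2 = -(i / 2) - 1 := by omega
      have h3 : (i + 1 - 1 : ℤ) / 2 = i / 2 := by omega
      have h4 : (i + 1 - 1 + 1 : ℤ) / 2 = (i + 1) / 2 := by omega
      rcases zmod_four_cases l with rfl | rfl | rfl | rfl <;>
        simp only [quarter_zero, quarter_one, quarter_two, quarter_three, quarterCell_zero,
          quarterCell_one, quarterCell_two, quarterCell_three, h0, h1, h2, h3, h4] <;>
        norm_num <;> ring_nf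
    · simp only [cell, average_four, pull, pos_pv, pos_dv, Kind.shift, latR]
      have h1 : (-(i + 1) - 1 : ℤ) / 2 = -((i + 1) / 2) - 1 := by omega
      have h2 : (-(i + 1) - 1 + 1 : ℤ) / 2 = -(i / 2) - 1 := by omega
      have h3 : (i + 1 - 1 : ℤ) / 2 = i / 2 := by omega
      have h4 : (i + 1 - 1 + 1 : ℤ) / 2 = (i + 1) / 2 := by omega
      have h5 : (-(j + 1) - 1 : ℤ) / 2 = -((j + 1) / 2) - 1 := by omega
      have h6 : (-(j + 1) - 1 + 1 : ℤ) / 2 = -(j / 2) - 1 := by omega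
      have h7 : (j + 1 - 1 : ℤ) / 2 = j / 2 := by omega
      have h8 : (j + 1 - 1 + 1 : ℤ) / 2 = (j + 1) / 2 := by omega
      rcases zmod_four_cases l with rfl | rfl | rfl | rfl <;>
        simp only [quarter_zero, quarter_one, quarter_two, quarter_three, quarterCell_zero,
          quarterCell_one, quarterCell_two, quarterCell_three, Nat.cast_add, Nat.cast_one, h1, h2,
          h3, h4, h5, h6, h7, h8] <;>
        push_cast <;> ring

theorem pos_rot {k : Kind} (v : Vertex 4 k) :
    pos (rot v) = (-(pos v).2 - k.shift, (pos v).1) := by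
  rcases v with _ | ⟨l, i, j⟩ | ⟨l, i, j⟩
  · rfl
  · simp only [rot, pos_pv, quarter_add_one, Kind.shift]
    rcases zmod_four_cases l with rfl | rfl | rfl | rfl <;>
      simp [quarter_zero, quarter_one, quarter_two, quarter_three]
  · simp only [rot, pos_dv, quarterCell_add_one, Kind.shift]
    rcases zmod_four_cases l with rfl | rfl | rfl | rfl <;>
      simp [quarterCell_zero, quarterCell_one, quarterCell_two, quarterCell_three]

theorem pos_faceSite {k : Kind} (v : Vertex 4 k.flip) : pos (faceSite v) =
    (2 * (pos v).1 + k.flip.shift, 2 * (pos v).2 + k.flip.shift) := by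
  rcases k with _ | _
  · rcases v with _ | _ | ⟨l, i, j⟩
    simp only [faceSite, pos_g, Kind.flip, Kind.shift, pos_dv]
    rcases zmod_four_cases l with rfl | rfl | rfl | rfl <;>
      simp only [quarter_zero, quarter_one, quarter_two, quarter_three, quarterCell_zero,
        quarterCell_one, quarterCell_two, quarterCell_three, Prod.mk.injEq] <;> omega
  · rcases v with _ | ⟨l, i, j⟩
    · rfl
    · simp only [faceSite, pos_g, Kind.flip, Kind.shift, pos_pv]
      rcases zmod_four_cases l with rfl | rfl | rfl | rfl <;>
        simp only [quarter_zero, quarter_one, quarter_two, quarter_three, Prod.mk.injEq] <;> omega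

theorem pos_edgeSite (v : Vertex 4 .dual) :
    pos (edgeSite v) = ((pos v).1 + (pos v).2 + 1, (pos v).2 - (pos v).1) := by
  rcases v with _ | _ | ⟨l, a, b⟩
  simp only [edgeSite, pos_dv]
  split_ifs with h
  · rw [pos_g]
    rcases zmod_four_cases l with rfl | rfl | rfl | rfl <;>
      simp only [quarter_zero, quarter_one, quarter_two, quarter_three, quarterCell_zero,
        quarterCell_one, quarterCell_two, quarterCell_three, Prod.mk.injEq] <;> omega
  · rw [pos_g, quarter_sub_one]
    rcases zmod_four_cases l with rfl | rfl | rfl | rfl <;>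
      simp only [quarter_zero, quarter_one, quarter_two, quarter_three, quarterCell_zero,
        quarterCell_one, quarterCell_two, quarterCell_three, Prod.mk.injEq] <;> omega

open Classical in
-- Membership is read off from the average of the indicator of w: the indicator is a product of
-- functions of one coordinate, so its average factors and is nonzero exactly if both factors are.
theorem mem_cell_iff {k : Kind} {x : Vertex 4 .primal} {w : Vertex 4 k} : w ∈ cell x ↔
    |2 * (pos w).1 + k.shift - (pos x).1| ≤ 1 ∧ |2 * (pos w).2 + k.shift - (pos x).2| ≤ 1 := by
  have h1 : (Pi.single w 1 : Mesh 4 k) = pull fun a b =>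
      (if a = (pos w).1 then 1 else 0) * (if b = (pos w).2 then 1 else 0) := by
    funext v
    rw [Pi.single_apply, pull]
    by_cases h : v = w
    · simp [h]
    · rw [if_neg h]
      symm
      rw [mul_eq_zero]
      by_contra! h2
      simp only [ne_eq, ite_eq_right_iff, one_ne_zero, imp_false, not_not] at h2
      exact h (pos_injective k (Prod.ext h2.1 h2.2))
  have h2 (p q : Prop) [Decidable p] [Decidable q] : ((if p then 1 else 0 : ℂ) + if q then 1 else 0) ≠ 0 ↔ p ∨ q := by
    split_ifs <;> simp [*]
  have h3 : ∀ a b c d : ℂ, (a * c + b * c + a * d + b * d) / 4 = (a + b) * (c + d) / 4 := by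
    intros; ring
  rw [← average_single_ne_zero, h1, average_cell_pull, latR, h3]
  simp only [ne_eq, div_eq_zero_iff, mul_eq_zero, not_or]
  rw [← ne_eq, ← ne_eq, h2, h2, abs_le, abs_le]
  have : ¬ (4 : ℂ) = 0 := by norm_num
  simp only [this, not_false_eq_true, and_true]
  omega

end Position

/-! ### The subdivision operator on the lattice and its contraction of second differences -/

section LatticeSubdivision

/-- The translations account for the half-unit offset of dual meshes in the integer coordinates. -/
def latOp : Op → Kind → (ℤ → ℤ → ℂ) → ℤ → ℤ → ℂ
  | .A, .primal, F => latA F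
  | .A, .dual, F => translate (-1) (-1) (latA F)
  | .V, .primal, F => latV F
  | .V, .dual, F => translate 0 (-1) (latV F)
  | .R, .primal, F => latR F
  | .R, .dual, F => translate (-1) (-1) (latR F)

theorem op_map_pull (o : Op) (k : Kind) (F : ℤ → ℤ → ℂ) :
    o.map k (pull F : Mesh 4 k) = pull (latOp o k F) := by
  funext v
  rw [Op.map_apply, average_cell_pull]
  cases o with
  | A =>
    have h := pos_faceSite v
    simp only [Op.site]
    rw [h]
    have e1 (x : ℤ) : (2 * x + 1 + 1) / 2 = x + 1 := by omega
    have e2 (x : ℤ) : (2 * x - 1) / 2 = x + -1 := by omega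
    have e3 (x : ℤ) : (2 * x - 1 + 1) / 2 = x := by omega
    cases k <;>
      simp only [pull, latOp, latR, latA, translate, Kind.flip, Kind.shift, sub_zero, add_zero,
        two_mul_ediv_two, e1, e2, e3, neg_add_cancel_right]
    all_goals rfl
  | V =>
    have h := pos_edgeSite v
    simp only [Op.site]
    rw [h]
    cases k
    · simp only [pull, latOp, latV, Kind.shift, sub_zero]
      rfl
    · simp only [pull, latOp, latV, Kind.shift, translate]
      congr 1 <;> ring_nf <;> rfl
  | R =>
    simp only [Op.site]
    cases k
    · simp only [pull, latOp, Kind.shift, sub_zero]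
      rfl
    · simp only [pull, latOp, Kind.shift, translate]
      rfl

def latWord : List Op → Kind → (ℤ → ℤ → ℂ) → ℤ → ℤ → ℂ
  | [], _, F => F
  | o :: w, k, F => latWord w (o.out k) (latOp o k F)

theorem wordMap_pull (w : List Op) (k : Kind) (F : ℤ → ℤ → ℂ) :
    wordMap w k (pull F : Mesh 4 k) = pull (latWord w k F) := by
  induction w generalizing k F with
  | nil => rfl
  | cons o w ih => rw [wordMap_cons_apply, op_map_pull, ih]; rfl

theorem cast_pull {k k' : Kind} (h : k' = k) (F : ℤ → ℤ → ℂ) :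
    LinearEquiv.cast (R := ℂ) (M := Mesh 4) h (pull F) = pull F := by
  subst h
  rfl

theorem pull_rot_iterate {k : Kind} (n : ℕ) (F : ℤ → ℤ → ℂ) (v : Vertex 4 k) :
    pull F (rot^[n] v) = pull ((turn k.shift)^[n] F) v := by
  induction n generalizing F with
  | zero => rfl
  | succ n ih =>
    rw [Function.iterate_succ_apply', Function.iterate_succ_apply, ← ih]
    simp only [pull, pos_rot, turn]

def latSubdivide (e : Exponents) (k : Kind) (F : ℤ → ℤ → ℂ) : ℤ → ℤ → ℂ :=
  (turn k.shift)^[e.totalV / 2] (latWord e.word k F)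

theorem subdivide_pull (e : Exponents) (k : Kind) (hk : e.Preserves k) (F : ℤ → ℤ → ℂ) :
    subdivide e k hk (pull F : Mesh 4 k) = pull (latSubdivide e k F) := by
  simp only [subdivide, LinearMap.comp_apply, wordMap_pull, LinearEquiv.coe_coe]
  have := cast_pull hk (latWord e.word k F)
  rw [this]
  funext v
  rw [LinearMap.funLeft_apply, pull_rot_iterate, latSubdivide]

theorem subdivide_pow_pull (e : Exponents) (k : Kind) (hk : e.Preserves k) (n : ℕ)
    (F : ℤ → ℤ → ℂ) :
    (subdivide e k hk ^ n) (pull F : Mesh 4 k) = pull ((latSubdivide e k)^[n] F) := by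
  induction n generalizing F with
  | zero => rfl
  | succ n ih => rw [pow_succ, Module.End.mul_apply, subdivide_pull, ih, Function.iterate_succ_apply]

/-- The factor by which an operator improves the bounds `DiagBound`. -/
def Op.diagRate : Op → ℝ
  | .A => 1
  | .V => 7 / 10
  | .R => 2⁻¹

theorem DiagBound.latOp {c : ℝ} {F : ℤ → ℤ → ℂ} (h : DiagBound c F) (o : Op) (k : Kind) :
    DiagBound (o.diagRate * c) (latOp o k F) := by
  have h1 : DiagBound (2⁻¹ * c) (MidpointSubdivision.latR F) := by
    rw [inv_mul_eq_div]
    exact h.latR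
  cases o <;> cases k <;> simp only [MidpointSubdivision.latOp, Op.diagRate, one_mul]
  · exact h.latA
  · exact h.latA.translate _ _
  · exact h.latV
  · exact h.latV.translate _ _
  · exact h1
  · exact h1.translate _ _

theorem DiagBound.latWord {c : ℝ} {F : ℤ → ℤ → ℂ} (h : DiagBound c F) (w : List Op) (k : Kind) :
    DiagBound ((w.map Op.diagRate).prod * c) (latWord w k F) := by
  induction w generalizing k F c with
  | nil =>
    rw [List.map_nil, List.prod_nil, one_mul]
    exact h
  | cons o w ih =>
    have := ih (h.latOp o k) (o.out k)
    rw [← mul_assoc, mul_comm _ o.diagRate] at this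
    rw [List.map_cons, List.prod_cons]
    exact this

theorem DiagBound.latSubdivide {c : ℝ} {F : ℤ → ℤ → ℂ} (h : DiagBound c F) (e : Exponents)
    (k : Kind) : DiagBound ((e.word.map Op.diagRate).prod * c) (latSubdivide e k F) := by
  have key (n : ℕ) {c : ℝ} {G : ℤ → ℤ → ℂ} (hG : DiagBound c G) :
      DiagBound c ((MidpointSubdivision.turn k.shift)^[n] G) := by
    induction n with
    | zero => exact hG
    | succ n ih => rw [Function.iterate_succ_apply']; exact ih.turn _
  exact key _ (h.latWord e.word k)

theorem prod_diagRate_lt (e : Exponents) (hv : 1 ≤ e.totalV) :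
    (e.word.map Op.diagRate).prod < e.sigma := by
  rw [e.sigma_eq_wordScale, wordScale, e.prod_map_word, e.prod_map_word]
  simp only [Op.diagRate, Op.scale, one_pow, one_mul]
  have h : (7 / 10 : ℝ) < (√2)⁻¹ := by
    rw [lt_inv_comm₀ (by norm_num) (by positivity), Real.sqrt_lt' (by norm_num)]
    norm_num
  gcongr

theorem AxisBound.latOp_A {c t : ℝ} {F : ℤ → ℤ → ℂ} (h : AxisBound c t F) (k : Kind) :
    AxisBound t t (latOp .A k F) := by
  cases k
  · exact h.latA
  · exact h.latA.translate _ _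

theorem AxisBound.latOp_R {c t : ℝ} {F : ℤ → ℤ → ℂ} (h : AxisBound c t F) (ht : t ≤ c) (k : Kind) :
    AxisBound (c / 2) (c / 4) (latOp .R k F) := by
  cases k
  · exact h.latR ht
  · exact (h.latR ht).translate _ _

/-- `A` replaces (c, t) by (t, t), and `R` replaces it by (c/2, c/4); both keep t ≤ c ≤ 2t. Relative
to the scaling factor, an `A` thus lowers c to t, and an `R` lowers t to c/2, wherever in the word
they occur. -/
theorem AxisBound.latWord {c t : ℝ} {F : ℤ → ℤ → ℂ} (h : AxisBound c t F) (ht : t ≤ c)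
    (hc : c ≤ 2 * t) {w : List Op} (hw : .V ∉ w) (k : Kind) :
    ∃ c' t', AxisBound c' t' (latWord w k F) ∧ c' ≤ wordScale w * c ∧ t' ≤ wordScale w * t ∧
      (.A ∈ w → c' ≤ wordScale w * t) ∧ (.R ∈ w → t' ≤ wordScale w * (c / 2)) := by
  induction w generalizing k F c t with
  | nil => exact ⟨c, t, h, by simp [wordScale], by simp [wordScale], by simp, by simp⟩
  | cons o w ih =>
    simp only [List.mem_cons, not_or] at hw
    have hs := (wordScale_pos w).le
    cases o with
    | A =>
      obtain ⟨c', t', h', h1, h2, h3, h4⟩ := ih (h.latOp_A k) le_rfl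
        (by linarith) hw.2 (Op.A.out k)
      refine ⟨c', t', h', ?_⟩
      simp only [wordScale_cons, Op.scale, one_mul, List.mem_cons, reduceCtorEq, false_or]
      refine ⟨h1.trans (by gcongr), h2, fun _ => h1, fun hR => (h4 hR).trans ?_⟩
      gcongr
    | V => simp at hw
    | R =>
      obtain ⟨c', t', h', h1, h2, h3, h4⟩ := ih (h.latOp_R ht k) (by linarith)
        (by linarith) hw.2 (Op.R.out k)
      refine ⟨c', t', h', ?_⟩
      simp only [wordScale_cons, Op.scale, List.mem_cons, reduceCtorEq, false_or]
      have e1 : wordScale w * (c / 4) ≤ wordScale w * (t / 2) :=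
        mul_le_mul_of_nonneg_left (by linarith) hs
      exact ⟨by linarith, by linarith, fun hA => by linarith [h3 hA], fun _ => by linarith⟩

theorem AxisBound.mono {c t c' t' : ℝ} {F : ℤ → ℤ → ℂ} (h : AxisBound c t F) (hc : c ≤ c')
    (ht : t ≤ t') : AxisBound c' t' F where
  xx x y := (h.xx x y).trans hc
  yy x y := (h.yy x y).trans hc
  xy x y := (h.xy x y).trans ht
  xx_x x y := (h.xx_x x y).trans (by linarith)
  yy_y x y := (h.yy_y x y).trans (by linarith)

/-- With t = τc, one application gives c' ≤ στc and t' ≤ σc/2. The ratio τ is reproduced as soon as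
τ² ≥ 1/2, and τ < 1 is the gain; τ = 3/4 satisfies both. -/
theorem AxisBound.latSubdivide {c : ℝ} {F : ℤ → ℤ → ℂ} (h : AxisBound c (3 / 4 * c) F)
    {e : Exponents} (hv : e.totalV = 0) (ha : 1 ≤ e.totalA) (hr : 1 ≤ e.totalR) (k : Kind) :
    AxisBound (3 / 4 * e.sigma * c) (3 / 4 * (3 / 4 * e.sigma * c)) (latSubdivide e k F) := by
  have hc : 0 ≤ c := (norm_nonneg _).trans (h.xx 0 0)
  have hV : .V ∉ e.word := by rw [e.mem_word_iff.2.1]; omega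
  have hA : .A ∈ e.word := by rw [e.mem_word_iff.1]; omega
  have hR : .R ∈ e.word := by rw [e.mem_word_iff.2.2]; omega
  obtain ⟨c', t', h', -, -, h3, h4⟩ := h.latWord (by linarith) (by linarith) hV k
  rw [MidpointSubdivision.latSubdivide, hv]
  have h5 := mul_nonneg (wordScale_pos e.word).le hc
  rw [e.sigma_eq_wordScale]
  exact h'.mono ((h3 hA).trans (by linarith)) ((h4 hR).trans (by linarith))

/-- The second differences of the iterates decay faster than the powers of the scaling factor. -/
theorem exists_second_differences_le (e : Exponents) (hav : 1 ≤ e.totalA + e.totalV)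
    (hvr : 1 ≤ e.totalV + e.totalR) (k : Kind) {F : ℤ → ℤ → ℂ} {B : ℝ}
    (hF : ∀ x y, ‖F x y‖ ≤ B) :
    ∃ κ C : ℝ, 0 ≤ κ ∧ κ < e.sigma ∧ ∀ n x y,
      ‖dxx ((latSubdivide e k)^[n] F) x y‖ ≤ κ ^ n * C ∧
      ‖dyy ((latSubdivide e k)^[n] F) x y‖ ≤ κ ^ n * C ∧
      ‖dxy ((latSubdivide e k)^[n] F) x y‖ ≤ κ ^ n * C := by
  have hB : 0 ≤ B := (norm_nonneg _).trans (hF 0 0)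
  have h2 (a : ℂ) (ha : ‖a‖ ≤ B) : ‖2 * a‖ ≤ 2 * B := by
    rw [norm_mul, Complex.norm_ofNat]
    linarith
  have hxx (x y : ℤ) : ‖dxx F x y‖ ≤ 4 * B :=
    (norm_add_le_of_le (norm_sub_le_of_le (hF _ _) (h2 _ (hF _ _))) (hF _ _)).trans (by linarith)
  have hyy (x y : ℤ) : ‖dyy F x y‖ ≤ 4 * B :=
    (norm_add_le_of_le (norm_sub_le_of_le (hF _ _) (h2 _ (hF _ _))) (hF _ _)).trans (by linarith)
  have hxy (x y : ℤ) : ‖dxy F x y‖ ≤ 4 * B :=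
    (norm_add_le_of_le (norm_sub_le_of_le (norm_sub_le_of_le (hF _ _) (hF _ _)) (hF _ _))
      (hF _ _)).trans (by linarith)
  have hσ : 0 < e.sigma := e.sigma_eq_wordScale ▸ wordScale_pos _
  rcases Nat.eq_zero_or_pos e.totalV with hv | hv
  -- Without `V` there are factors `A` and `R`. Second differences are at most 4B, and 8B leaves
  -- room for the bound 3/4 · 8B on mixed differences.
  · have h0 : AxisBound (8 * B) (3 / 4 * (8 * B)) F :=
      ⟨fun x y => (hxx x y).trans (by linarith), fun x y => (hyy x y).trans (by linarith),
        fun x y => (hxy x y).trans (by linarith),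
        fun x y => (norm_add_le_of_le (hxx _ _) (hxx _ _)).trans (by linarith),
        fun x y => (norm_add_le_of_le (hyy _ _) (hyy _ _)).trans (by linarith)⟩
    have h (n : ℕ) : AxisBound ((3 / 4 * e.sigma) ^ n * (8 * B))
        (3 / 4 * ((3 / 4 * e.sigma) ^ n * (8 * B))) ((latSubdivide e k)^[n] F) := by
      induction n with
      | zero => simpa using h0
      | succ n ih =>
        rw [Function.iterate_succ_apply', pow_succ', mul_assoc _ _ (8 * B)]
        exact ih.latSubdivide hv (by omega) (by omega) k
    refine ⟨3 / 4 * e.sigma, 8 * B, by positivity, by linarith, fun n x y =>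
      ⟨(h n).xx x y, (h n).yy x y, ((h n).xy x y).trans ?_⟩⟩
    have : 0 ≤ (3 / 4 * e.sigma) ^ n * (8 * B) := by positivity
    linarith
  -- Sums of two second differences are at most 8B, which is 4/5 · 10B.
  · have h0 : DiagBound (10 * B) F :=
      ⟨fun x y => (hxx x y).trans (by linarith), fun x y => (hyy x y).trans (by linarith),
        fun x y => by
          rw [ddiag_eq]
          exact (norm_sub_le_of_le (hxx _ _) (hyy _ _)).trans (by linarith),
        fun x y => (hxy x y).trans (by linarith),
        fun x y => (norm_add_le_of_le (hxy _ _) (hxy _ _)).trans (by linarith),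
        fun x y => (norm_add_le_of_le (hxy _ _) (hxy _ _)).trans (by linarith)⟩
    set κ := (e.word.map Op.diagRate).prod with hκ
    have h (n : ℕ) : DiagBound (κ ^ n * (10 * B)) ((latSubdivide e k)^[n] F) := by
      induction n with
      | zero => simpa using h0
      | succ n ih =>
        rw [Function.iterate_succ_apply', pow_succ', mul_assoc _ _ (10 * B)]
        exact ih.latSubdivide e k
    have hκ0 : 0 ≤ κ := by
      refine List.prod_nonneg fun a ha => ?_
      obtain ⟨o, -, rfl⟩ := List.mem_map.1 ha
      cases o <;> norm_num [Op.diagRate]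
    refine ⟨κ, 10 * B, hκ0, prod_diagRate_lt e hv, fun n x y =>
      ⟨(h n).xx x y, (h n).yy x y, ((h n).xy x y).trans ?_⟩⟩
    have : 0 ≤ κ ^ n * (10 * B) := by positivity
    linarith

end LatticeSubdivision

/-! ### Affine approximation of the iterates in valence four -/

section Affine

theorem segmentAngle_four : segmentAngle 4 1 = Real.pi / 2 := by
  rw [segmentAngle]
  push_cast
  ring

/-- The position of a lattice point in the plane. -/
def latCoord (k : Kind) (x y : ℤ) : ℂ :=
  ((x : ℂ) + k.shift / 2) + Complex.I * ((y : ℂ) + k.shift / 2)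

theorem gridMesh_eq_pull (k : Kind) : gridMesh 1 k = (pull (latCoord k) : Mesh 4 k) := by
  have h0 : spoke (0 : ZMod 4) = 1 := rfl
  have h1 : spoke (1 : ZMod 4) = Complex.I := pow_one _
  have h2 : spoke (2 : ZMod 4) = -1 := Complex.I_sq
  have h3 : spoke (3 : ZMod 4) = -Complex.I := Complex.I_pow_three
  funext v
  rcases v with _ | ⟨l, i, j⟩ | ⟨l, i, j⟩
  · simp [gridMesh, pull, pos_center, latCoord, Kind.shift]
  · have h := gridMesh_g segmentAngle_four l (i + 1) j
    simp only [g] at h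
    rw [h, pull, pos_pv, latCoord]
    rcases zmod_four_cases l with rfl | rfl | rfl | rfl <;>
      simp only [quarter_zero, quarter_one, quarter_two, quarter_three, h0, h1, h2, h3,
        Kind.shift] <;> push_cast
    · ring
    · linear_combination (j : ℂ) * Complex.I_sq
    · ring
    · linear_combination (-j : ℂ) * Complex.I_sq
  · rw [gridMesh_dv segmentAngle_four, pull, pos_dv, latCoord]
    rcases zmod_four_cases l with rfl | rfl | rfl | rfl <;>
      simp only [quarterCell_zero, quarterCell_one, quarterCell_two, quarterCell_three, h0, h1, h2,
        h3, Kind.shift] <;> push_cast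
    · ring
    · linear_combination (j + 1 / 2 : ℂ) * Complex.I_sq
    · ring
    · linear_combination (-j - 1 / 2 : ℂ) * Complex.I_sq

/-- The functions 1, z and its conjugate span all complex-valued affine functions of the plane. -/
def affineMesh (k : Kind) (t a b : ℂ) : Mesh 4 k :=
  t • 1 + a • gridMesh 1 k + b • star (gridMesh 1 k)

theorem subdivide_affineMesh (e : Exponents) (hv : Even e.totalV) (k : Kind) (hk : e.Preserves k)
    (t a b : ℂ) : subdivide e k hk (affineMesh k t a b) =
      affineMesh k t (e.sigma * a) (e.sigma * b) := by
  have hU := isAveraging_subdivide (m := 4) e k hk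
  rw [affineMesh, map_add, map_add, map_smul, map_smul, map_smul, hU.map_one, hU.map_star,
    subdivide_gridMesh segmentAngle_four e hv, star_smul, smul_smul, smul_smul, affineMesh,
    mul_comm a, mul_comm b]
  simp

/-- Two neighbouring values and the second differences determine all others by a recursion in both
directions; only finitely many steps are needed for each x, so pointwise limits suffice. -/
theorem tendsto_zero_of_second_difference {u : ℕ → ℤ → ℂ}
    (h0 : Tendsto (fun n => u n 0) atTop (𝓝 0)) (h1 : Tendsto (fun n => u n 1) atTop (𝓝 0))
    (h2 : ∀ x, Tendsto (fun n => u n (x + 2) - 2 * u n (x + 1) + u n x) atTop (𝓝 0)) (x : ℤ) :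
    Tendsto (fun n => u n x) atTop (𝓝 0) := by
  have key : Tendsto (fun n => u n x) atTop (𝓝 0) ∧ Tendsto (fun n => u n (x + 1)) atTop (𝓝 0) := by
    induction x using Int.induction_on with
    | zero => exact ⟨h0, by simpa using h1⟩
    | succ i ih =>
      refine ⟨ih.2, ?_⟩
      have := ((h2 i).add (ih.2.const_mul 2)).sub ih.1
      simp only [mul_zero, add_zero, sub_zero] at this
      refine this.congr fun n => ?_
      rw [show (i : ℤ) + 1 + 1 = i + 2 by ring]
      ring
    | pred i ih =>
      have := ((h2 (-i - 1)).add (ih.1.const_mul 2)).sub ih.2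
      simp only [mul_zero, add_zero, sub_zero] at this
      refine ⟨this.congr fun n => ?_, by simpa using ih.1⟩
      rw [show (-i - 1 : ℤ) + 2 = -i + 1 by ring, show (-i - 1 : ℤ) + 1 = -i by ring]
      ring
  exact key.1

theorem tendsto_zero_of_second_differences {E : ℕ → ℤ → ℤ → ℂ}
    (h00 : Tendsto (fun n => E n 0 0) atTop (𝓝 0)) (h10 : Tendsto (fun n => E n 1 0) atTop (𝓝 0))
    (h01 : Tendsto (fun n => E n 0 1) atTop (𝓝 0))
    (hxx : ∀ x y, Tendsto (fun n => dxx (E n) x y) atTop (𝓝 0))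
    (hyy : ∀ x y, Tendsto (fun n => dyy (E n) x y) atTop (𝓝 0))
    (hxy : ∀ x y, Tendsto (fun n => dxy (E n) x y) atTop (𝓝 0)) (x y : ℤ) :
    Tendsto (fun n => E n x y) atTop (𝓝 0) := by
  have row0 (x : ℤ) : Tendsto (fun n => E n x 0) atTop (𝓝 0) :=
    tendsto_zero_of_second_difference (u := fun n x => E n x 0) h00 h10 (fun x => hxx x 0) x
  have row1 (x : ℤ) : Tendsto (fun n => E n x 1) atTop (𝓝 0) := by
    induction x using Int.induction_on with
    | zero => exact h01
    | succ i ih =>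
      have := (((hxy i 0).add (row0 (i + 1))).add ih).sub (row0 i)
      simp only [add_zero, sub_zero] at this
      refine this.congr fun n => ?_
      simp only [dxy, zero_add]
      ring
    | pred i ih =>
      have := ((ih.sub (hxy (-i - 1) 0)).sub (row0 (-i))).add (row0 (-i - 1))
      simp only [add_zero, sub_zero] at this
      refine this.congr fun n => ?_
      simp only [dxy, zero_add, sub_add_cancel]
      ring
  exact tendsto_zero_of_second_difference (u := fun n => E n x) (row0 x) (row1 x) (hyy x) y

/-- The affine function with the same values as `G` at `(0, 0)`, `(1, 0)` and `(0, 1)`. -/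
theorem exists_affine_interpolation (k : Kind) (G : ℤ → ℤ → ℂ) : ∃ t a b : ℂ, ∃ L : ℤ → ℤ → ℂ,
    affineMesh k t a b = pull L ∧ L 0 0 = G 0 0 ∧ L 1 0 = G 1 0 ∧ L 0 1 = G 0 1 ∧
      ∀ x y, dxx L x y = 0 ∧ dyy L x y = 0 ∧ dxy L x y = 0 := by
  set p := G 1 0 - G 0 0 with hp
  set q := G 0 1 - G 0 0 with hq
  -- The coefficients of px + qy in terms of z = x + iy and its conjugate.
  set a := (p - Complex.I * q) / 2 with ha
  set b := (p + Complex.I * q) / 2 with hb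
  have hI := Complex.I_sq
  have hL (x y : ℤ) : a * latCoord k x y + b * star (latCoord k x y) =
      p * (x + k.shift / 2) + q * (y + k.shift / 2) := by
    simp only [latCoord, ha, hb, Complex.star_def, map_add, map_mul, map_div₀, Complex.conj_I,
      map_intCast, map_ofNat]
    linear_combination (-(q * ((y : ℂ) + k.shift / 2))) * hI
  refine ⟨G 0 0 - (p * (k.shift / 2) + q * (k.shift / 2)), a, b,
    fun x y => G 0 0 + p * x + q * y, ?_, by simp, by simp [hp], by simp [hq], fun x y => ?_⟩
  · funext v
    have := hL (pos v).1 (pos v).2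
    rw [affineMesh, gridMesh_eq_pull]
    simp only [Pi.add_apply, Pi.smul_apply, Pi.one_apply, smul_eq_mul, mul_one, Pi.star_apply, pull]
    rw [add_assoc, this]
    ring
  · simp only [dxx, dyy, dxy]
    push_cast
    refine ⟨?_, ?_, ?_⟩ <;> ring

theorem sigma_pos (e : Exponents) : 0 < e.sigma := e.sigma_eq_wordScale ▸ wordScale_pos _

theorem sigma_lt_one {e : Exponents} (hvr : 1 ≤ e.totalV + e.totalR) : e.sigma < 1 := by
  refine Real.rpow_lt_one_of_one_lt_of_neg one_lt_two ?_
  have : (1 : ℝ) ≤ e.totalV + e.totalR := by exact_mod_cast hvr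
  have h1 : (0 : ℝ) ≤ e.totalR := by positivity
  linarith

variable (e : Exponents) (hav : 1 ≤ e.totalA + e.totalV) (hvr : 1 ≤ e.totalV + e.totalR)
  (k : Kind) (hk : e.Preserves k)

include hav hvr in
theorem exists_affine_approximation {f : Mesh 4 k} {B : ℝ} (hf : ∀ v, ‖f v‖ ≤ B) :
    ∃ t a b : ℕ → ℂ, Tendsto (fun n => ((e.sigma : ℂ) ^ n)⁻¹ •
      ((subdivide e k hk ^ n) f - affineMesh k (t n) (a n) (b n))) atTop (𝓝 0) := by
  have hB : 0 ≤ B := (norm_nonneg _).trans (hf (pos_surjective k (0, 0)).choose)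
  -- The default value 0 is never taken, as `pos` is bijective.
  set F : ℤ → ℤ → ℂ := fun x y => Function.extend pos f 0 (x, y) with hF
  have hfF : f = pull F := by
    funext v
    exact ((pos_injective k).extend_apply f 0 v).symm
  have hFB (x y : ℤ) : ‖F x y‖ ≤ B := by
    obtain ⟨v, hv⟩ := pos_surjective k (x, y)
    simp only [hF]
    rw [← hv, (pos_injective k).extend_apply]
    exact hf v
  obtain ⟨κ, C, hκ0, hκ, hbd⟩ := exists_second_differences_le e hav hvr k hFB
  choose t a b L hTL hL00 hL10 hL01 hL using
    fun n => exists_affine_interpolation k ((latSubdivide e k)^[n] F)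
  refine ⟨t, a, b, ?_⟩
  set s : ℕ → ℂ := fun n => ((e.sigma : ℂ) ^ n)⁻¹ with hs
  have hσ := sigma_pos e
  have hlim : Tendsto (fun n => (κ / e.sigma) ^ n * C) atTop (𝓝 0) := by
    have := (tendsto_pow_atTop_nhds_zero_of_lt_one (div_nonneg hκ0 hσ.le)
      ((div_lt_one hσ).2 hκ)).mul_const C
    simpa using this
  have hsq {u : ℕ → ℂ} (hu : ∀ n, ‖u n‖ ≤ κ ^ n * C) :
      Tendsto (fun n => s n * u n) atTop (𝓝 0) := by
    refine squeeze_zero_norm (fun n => ?_) hlim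
    rw [norm_mul, hs, norm_inv, norm_pow, Complex.norm_real, Real.norm_of_nonneg hσ.le, div_pow,
      div_mul_eq_mul_div, inv_mul_eq_div]
    gcongr
    exact hu n
  -- The rescaled error vanishes at the three interpolation points, and its second differences are
  -- those of the iterate, divided by σ^n, because L is affine.
  set E : ℕ → ℤ → ℤ → ℂ := fun n x y => s n * ((latSubdivide e k)^[n] F x y - L n x y) with hE
  have hE0 : ∀ x y, Tendsto (fun n => E n x y) atTop (𝓝 0) := by
    refine tendsto_zero_of_second_differences ?_ ?_ ?_ (fun x y => ?_) (fun x y => ?_)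
      (fun x y => ?_)
    · simp [hE, hL00]
    · simp [hE, hL10]
    · simp [hE, hL01]
    · refine (hsq fun n => (hbd n x y).1).congr fun n => ?_
      have := (hL n x y).1
      simp only [dxx, hE] at this ⊢
      linear_combination (s n) * this
    · refine (hsq fun n => (hbd n x y).2.1).congr fun n => ?_
      have := (hL n x y).2.1
      simp only [dyy, hE] at this ⊢
      linear_combination (s n) * this
    · refine (hsq fun n => (hbd n x y).2.2).congr fun n => ?_
      have := (hL n x y).2.2
      simp only [dxy, hE] at this ⊢
      linear_combination (s n) * this
  refine tendsto_pi_nhds.2 fun v => ?_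
  refine (hE0 (pos v).1 (pos v).2).congr fun n => ?_
  rw [hfF, subdivide_pow_pull, hTL]
  rfl

end Affine

/-! ### The nets around the core in valence four -/

section Nets

variable {k k' k'' : Kind}

/-! ### Reach of the operators and finiteness of the core -/

theorem norm_factor (o : Op) : ‖o.factor‖ = o.scale := by
  cases o with
  | A => simp [Op.factor, Op.scale]
  | V =>
    have h : ‖(1 - Complex.I : ℂ)‖ = √2 := by
      rw [Complex.norm_def, Complex.normSq_apply]
      norm_num
    rw [Op.factor, Op.scale, norm_div, h, Complex.norm_ofNat, div_eq_iff two_ne_zero,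
      inv_mul_eq_div, eq_div_iff (by positivity)]
    exact Real.mul_self_sqrt two_pos.le
  | R => simp [Op.factor, Op.scale]

open Classical in
/-- The vertices that influence the value at `v` have at most the distance `s * |v| + C` from the
center. -/
def HasReach (s C : ℝ) (T : Mesh 4 k →ₗ[ℂ] Mesh 4 k') : Prop :=
  ∀ v w, T (Pi.single w 1) v ≠ 0 → ‖gridMesh 1 k w‖ ≤ s * ‖gridMesh 1 k' v‖ + C

theorem HasReach.id : HasReach 1 0 (LinearMap.id : Mesh 4 k →ₗ[ℂ] Mesh 4 k) := by
  classical
  intro v w h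
  have : v = w := by
    by_contra hvw
    exact h (by simp [hvw])
  rw [this, one_mul, add_zero]

theorem HasReach.comp {s s' C C' : ℝ} {S : Mesh 4 k' →ₗ[ℂ] Mesh 4 k''}
    {T : Mesh 4 k →ₗ[ℂ] Mesh 4 k'} (hS : HasReach s' C' S) (hT : HasReach s C T) (hs : 0 ≤ s)
    (hSa : IsAveraging S) : HasReach (s * s') (s * C' + C) (S ∘ₗ T) := by
  intro v w h
  obtain ⟨y, hy, hw⟩ := hSa.exists_of_comp_ne_zero h
  refine (hT y w hw).trans ?_
  have := mul_le_mul_of_nonneg_left (hS v y hy) hs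
  linarith

/-- The center of the averaged cell is the grid position of v times the factor of the operator, and
each vertex of a cell is within 1/2 of that center in each coordinate. -/
theorem hasReach_op (o : Op) (k : Kind) : HasReach o.scale 1 (o.map (m := 4) k) := by
  classical
  intro v w h
  have h1 := congrFun (op_map_gridMesh segmentAngle_four o k) v
  rw [Op.map_apply, average_cell_gridMesh segmentAngle_four, Pi.smul_apply, smul_eq_mul] at h1
  rw [Op.map_apply, average_single_ne_zero, mem_cell_iff] at h
  rw [← norm_factor, ← norm_mul, ← h1, gridMesh_eq_pull, gridMesh_eq_pull]
  have h2 : (pull (latCoord k) w : ℂ) = 2⁻¹ * pull (latCoord .primal) (o.site v) +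
      (((2 * (pos w).1 + k.shift - (pos (o.site v)).1 : ℤ) : ℂ) +
        Complex.I * ((2 * (pos w).2 + k.shift - (pos (o.site v)).2 : ℤ) : ℂ)) / 2 := by
    simp only [pull, latCoord, Kind.shift]
    push_cast
    ring
  rw [h2]
  refine (norm_add_le _ _).trans (add_le_add le_rfl ?_)
  rw [norm_div, Complex.norm_ofNat, div_le_one two_pos]
  refine (norm_add_le _ _).trans ?_
  rw [norm_mul, Complex.norm_I, one_mul, Complex.norm_intCast, Complex.norm_intCast]
  have h3 : |((2 * (pos w).1 + k.shift - (pos (o.site v)).1 : ℤ) : ℝ)| ≤ 1 := by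
    exact_mod_cast h.1
  have h4 : |((2 * (pos w).2 + k.shift - (pos (o.site v)).2 : ℤ) : ℝ)| ≤ 1 := by
    exact_mod_cast h.2
  linarith

theorem hasReach_wordMap (w : List Op) (k : Kind) :
    ∃ C, HasReach (wordScale w) C (wordMap (m := 4) w k) := by
  induction w generalizing k with
  | nil =>
    refine ⟨0, ?_⟩
    rw [wordScale, List.map_nil, List.prod_nil]
    exact HasReach.id
  | cons o w ih =>
    obtain ⟨C, hC⟩ := ih (o.out k)
    rw [wordScale_cons]
    exact ⟨_, hC.comp (hasReach_op o k) o.scale_pos.le (isAveraging_wordMap w _)⟩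

theorem hasReach_subdivide (e : Exponents) (k : Kind) (hk : e.Preserves k) :
    ∃ C, HasReach e.sigma C (subdivide (m := 4) e k hk) := by
  classical
  obtain ⟨C, hC⟩ := hasReach_wordMap e.word k
  have h1 {k' : Kind} (h : k' = k) :
      HasReach 1 0 (LinearEquiv.cast (R := ℂ) (M := Mesh 4) h).toLinearMap := by
    subst h
    exact HasReach.id
  have h2 : HasReach 1 0
      (LinearMap.funLeft ℂ ℂ (rot^[e.totalV / 2]) : Mesh 4 k →ₗ[ℂ] Mesh 4 k) := by
    intro v w h
    have : rot^[e.totalV / 2] v = w := by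
      by_contra hvw
      exact h (by rw [LinearMap.funLeft_apply, Pi.single_eq_of_ne hvw])
    rw [← this, gridMesh_rot_iterate segmentAngle_four, norm_mul, norm_pow, Complex.norm_I, one_pow,
      one_mul, add_zero]
  have h3 := h2.comp ((h1 hk).comp hC (wordScale_pos _).le (isAveraging_cast hk))
    (by simpa using (wordScale_pos _).le) (isAveraging_funLeft _)
  rw [mul_one, mul_one, ← e.sigma_eq_wordScale] at h3
  exact ⟨_, h3⟩

theorem finite_setOf_norm_gridMesh_le (k : Kind) (K : ℝ) :
    {v : Vertex 4 k | ‖gridMesh 1 k v‖ ≤ K}.Finite := by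
  refine Set.Finite.subset (((Set.finite_Icc (-⌈K⌉ - 1) ⌈K⌉).prod
    (Set.finite_Icc (-⌈K⌉ - 1) ⌈K⌉)).preimage (pos_injective k).injOn) fun v hv => ?_
  have hs : (0 : ℝ) ≤ k.shift ∧ (k.shift : ℝ) ≤ 1 := by cases k <;> simp [Kind.shift]
  rw [Set.mem_ofPred_eq, gridMesh_eq_pull, pull] at hv
  have hre := abs_le.1 ((Complex.abs_re_le_norm _).trans hv)
  have him := abs_le.1 ((Complex.abs_im_le_norm _).trans hv)
  simp [latCoord] at hre him
  have hK := Int.le_ceil K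
  simp only [Set.mem_preimage, Set.mem_prod, Set.mem_Icc]
  refine ⟨⟨?_, ?_⟩, ?_, ?_⟩ <;> rify <;> linarith

theorem finite_core {e : Exponents} (hvr : 1 ≤ e.totalV + e.totalR) (hk : e.Preserves k) :
    (core (m := 4) e k hk).Finite := by
  classical
  obtain ⟨C, hC⟩ := hasReach_subdivide e k hk
  have hσ := sigma_lt_one hvr
  -- The ball of radius K contains the central vertices, as K ≥ 1, and everything that influences
  -- it, as σK + C ≤ K.
  set K := max 1 (C / (1 - e.sigma)) with hK
  have hK2 : e.sigma * K + C ≤ K := by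
    have := (div_le_iff₀ (by linarith)).1 (le_max_right 1 (C / (1 - e.sigma)))
    rw [← hK] at this
    linarith
  refine (finite_setOf_norm_gridMesh_le k K).subset ?_
  have key (n : ℕ) (c w : Vertex 4 k) (h : (subdivide e k hk ^ n) (Pi.single w 1) c ≠ 0)
      (hc : ‖gridMesh 1 k c‖ ≤ K) : ‖gridMesh 1 k w‖ ≤ K := by
    induction n generalizing w with
    | zero =>
      have : c = w := by
        by_contra hcw
        exact h (by simp [hcw])
      exact this ▸ hc
    | succ n ih =>
      rw [pow_succ, Module.End.mul_apply] at h
      obtain ⟨y, hy, hw⟩ := ((isAveraging_subdivide e k hk).pow n).exists_of_comp_ne_zero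
        (w := w) (by convert h)
      refine (hC y w hw).trans (le_trans ?_ hK2)
      have := mul_le_mul_of_nonneg_left (ih y (by convert hy)) (sigma_pos e).le
      linarith
  rintro w ⟨n, -, c, hc, hw⟩
  refine key n c w (by convert hw) ?_
  refine le_trans ?_ (le_max_left _ _)
  have hc2 := mem_cell_iff.1 hc
  rw [pos_center, sub_zero, sub_zero] at hc2
  have h2 : gridMesh 1 k c = (((2 * (pos c).1 + k.shift : ℤ) : ℂ) +
      Complex.I * ((2 * (pos c).2 + k.shift : ℤ) : ℂ)) / 2 := by
    rw [gridMesh_eq_pull]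
    simp only [pull, latCoord]
    push_cast
    ring
  rw [h2, norm_div, Complex.norm_ofNat, div_le_one two_pos]
  refine (norm_add_le _ _).trans ?_
  rw [norm_mul, Complex.norm_I, one_mul, Complex.norm_intCast, Complex.norm_intCast]
  have h3 : |((2 * (pos c).1 + k.shift : ℤ) : ℝ)| ≤ 1 := by exact_mod_cast hc2.1
  have h4 : |((2 * (pos c).2 + k.shift : ℤ) : ℝ)| ≤ 1 := by exact_mod_cast hc2.2
  linarith

/-! ### Face sharing, and invariance and finiteness of the nets -/

theorem shareFace_iff {v w : Vertex 4 k} :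
    ShareFace v w ↔ |(pos v).1 - (pos w).1| ≤ 1 ∧ |(pos v).2 - (pos w).2| ≤ 1 := by
  have hs : (k.shift = 0 ∧ k.flip.shift = 1) ∨ (k.shift = 1 ∧ k.flip.shift = 0) := by
    cases k <;> simp [Kind.shift, Kind.flip]
  have h1 (s s' p q : ℤ) (hs : (s = 0 ∧ s' = 1) ∨ (s = 1 ∧ s' = 0)) (h : |p - q| ≤ 1) :
      ∃ c, |2 * p + s - (2 * c + s')| ≤ 1 ∧ |2 * q + s - (2 * c + s')| ≤ 1 := by
    simp only [abs_le] at h ⊢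
    rcases hs with ⟨rfl, rfl⟩ | ⟨rfl, rfl⟩
    · exact ⟨min p q, by omega⟩
    · exact ⟨max p q, by omega⟩
  constructor
  · rintro ⟨f, hv, hw⟩
    rw [mem_cell_iff, pos_faceSite] at hv hw
    simp only [abs_le] at hv hw ⊢
    omega
  · rintro ⟨hx, hy⟩
    obtain ⟨a, ha⟩ := h1 _ _ _ _ hs hx
    obtain ⟨b, hb⟩ := h1 _ _ _ _ hs hy
    obtain ⟨f, hf⟩ := pos_surjective k.flip (a, b)
    refine ⟨f, ?_, ?_⟩ <;> rw [mem_cell_iff, pos_faceSite, hf]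
    · exact ⟨ha.1, hb.1⟩
    · exact ⟨ha.2, hb.2⟩

theorem shareFace_refl (v : Vertex 4 k) : ShareFace v v := by
  rw [shareFace_iff]
  simp

open Classical in
/-- If two vertices share a face, then each vertex that influences the first one shares a face with
a vertex that influences the second one. -/
def PreservesSharing (T : Mesh 4 k →ₗ[ℂ] Mesh 4 k') : Prop :=
  ∀ v v', ShareFace v v' → ∀ x, T (Pi.single x 1) v ≠ 0 →
    ∃ x', T (Pi.single x' 1) v' ≠ 0 ∧ ShareFace x x'

theorem PreservesSharing.comp {S : Mesh 4 k' →ₗ[ℂ] Mesh 4 k''} {T : Mesh 4 k →ₗ[ℂ] Mesh 4 k'}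
    (hS : PreservesSharing S) (hT : PreservesSharing T) (hSa : IsAveraging S)
    (hTa : IsAveraging T) : PreservesSharing (S ∘ₗ T) := by
  intro v v' hv x hx
  obtain ⟨y, hy, hyx⟩ := hSa.exists_of_comp_ne_zero hx
  obtain ⟨y', hy', hyy⟩ := hS v v' hv y hy
  obtain ⟨x', hx', hxx⟩ := hT y y' hyy x hyx
  exact ⟨x', hSa.comp_ne_zero hTa hy' hx', hxx⟩

theorem preservesSharing_funLeft {σ : Vertex 4 k' → Vertex 4 k}
    (h : ∀ v v', ShareFace v v' → ShareFace (σ v) (σ v')) :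
    PreservesSharing (LinearMap.funLeft ℂ ℂ σ : Mesh 4 k →ₗ[ℂ] Mesh 4 k') := by
  classical
  intro v v' hv x hx
  have : σ v = x := by
    by_contra hvx
    exact hx (by rw [LinearMap.funLeft_apply, Pi.single_eq_of_ne hvx])
  refine ⟨σ v', ?_, this ▸ h v v' hv⟩
  rw [LinearMap.funLeft_apply, Pi.single_eq_same]
  exact one_ne_zero

theorem site_sub_site_le {o : Op} {v v' : Vertex 4 (o.out k)} (h : ShareFace v v') :
    |(pos (o.site v)).1 - (pos (o.site v')).1| ≤ 2 ∧
      |(pos (o.site v)).2 - (pos (o.site v')).2| ≤ 2 := by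
  rw [shareFace_iff] at h
  cases o with
  | A =>
    have h1 := pos_faceSite v
    have h2 := pos_faceSite v'
    simp only [Op.site, Op.out] at *
    rw [h1, h2]
    simp only [abs_le] at h ⊢
    omega
  | V =>
    have h1 := pos_edgeSite v
    have h2 := pos_edgeSite v'
    simp only [Op.site, Op.out] at *
    rw [h1, h2]
    simp only [abs_le] at h ⊢
    omega
  | R =>
    simp only [Op.site, Op.out] at *
    exact ⟨h.1.trans (by norm_num), h.2.trans (by norm_num)⟩

/-- The cells averaged for two vertices of a common face have centers at most two refined steps
apart in each coordinate. A vertex of one cell therefore reaches the other by moving at most one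
step per coordinate. -/
theorem preservesSharing_op (o : Op) (k : Kind) : PreservesSharing (o.map (m := 4) k) := by
  classical
  intro v v' hv x hx
  rw [Op.map_apply, average_single_ne_zero, mem_cell_iff] at hx
  have hs := site_sub_site_le hv
  have h1 (p c s s' : ℤ) (h : |2 * p + c - s| ≤ 1) (h2 : |s - s'| ≤ 2) :
      ∃ q, |2 * q + c - s'| ≤ 1 ∧ |p - q| ≤ 1 := by
    simp only [abs_le] at *
    rcases lt_trichotomy (s - s') 0 with h0 | h0 | h0
    · by_cases h3 : -1 ≤ 2 * p + c - s'
      · exact ⟨p, by omega⟩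
      · exact ⟨p + 1, by omega⟩
    · exact ⟨p, by omega⟩
    · by_cases h3 : 2 * p + c - s' ≤ 1
      · exact ⟨p, by omega⟩
      · exact ⟨p - 1, by omega⟩
  obtain ⟨a, ha⟩ := h1 _ _ _ _ hx.1 hs.1
  obtain ⟨b, hb⟩ := h1 _ _ _ _ hx.2 hs.2
  obtain ⟨x', hx'⟩ := pos_surjective k (a, b)
  refine ⟨x', ?_, ?_⟩
  · rw [Op.map_apply, average_single_ne_zero, mem_cell_iff, hx']
    exact ⟨ha.1, hb.1⟩
  · rw [shareFace_iff, hx']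
    exact ⟨ha.2, hb.2⟩

theorem preservesSharing_wordMap (w : List Op) (k : Kind) :
    PreservesSharing (wordMap (m := 4) w k) := by
  induction w generalizing k with
  | nil => exact preservesSharing_funLeft (σ := _root_.id) fun v v' h => h
  | cons o w ih =>
    exact (ih _).comp (preservesSharing_op o k) (isAveraging_wordMap w _) (isAveraging_op o k)

theorem preservesSharing_subdivide (e : Exponents) (k : Kind) (hk : e.Preserves k) :
    PreservesSharing (subdivide (m := 4) e k hk) := by
  have h1 {k' : Kind} (h : k' = k) :
      PreservesSharing (LinearEquiv.cast (R := ℂ) (M := Mesh 4) h).toLinearMap := by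
    subst h
    exact preservesSharing_funLeft (σ := _root_.id) fun v v' h => h
  have h2 (n : ℕ) (v v' : Vertex 4 k) (h : ShareFace v v') :
      ShareFace (rot^[n] v) (rot^[n] v') := by
    induction n with
    | zero => exact h
    | succ n ih =>
      rw [shareFace_iff] at ih
      rw [Function.iterate_succ_apply', Function.iterate_succ_apply', shareFace_iff, pos_rot,
        pos_rot]
      simp only [abs_le] at ih ⊢
      omega
  exact (preservesSharing_funLeft (h2 _)).comp ((h1 hk).comp (preservesSharing_wordMap _ _)
    (isAveraging_cast hk) (isAveraging_wordMap _ _)) (isAveraging_funLeft _)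
    ((isAveraging_cast hk).comp (isAveraging_wordMap _ _))

theorem isInvariant_coreNet (e : Exponents) (hk : e.Preserves k) (ρ : ℕ) :
    IsInvariant (subdivide (m := 4) e k hk) (coreNet e k hk ρ) := by
  induction ρ with
  | zero => exact isInvariant_core e hk
  | succ ρ ih =>
    rintro v ⟨v', hv', hvv⟩ x hx
    obtain ⟨x', hx', hxx⟩ := preservesSharing_subdivide e k hk v v' hvv x hx
    exact ⟨x', ih v' hv' x' hx', hxx⟩

theorem finite_coreNet {e : Exponents} (hvr : 1 ≤ e.totalV + e.totalR) (hk : e.Preserves k)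
    (ρ : ℕ) : (coreNet (m := 4) e k hk ρ).Finite := by
  induction ρ with
  | zero => exact finite_core hvr hk
  | succ ρ ih =>
    refine (ih.biUnion (t := fun w => {v | ShareFace v w}) fun w _ => ?_).subset ?_
    · refine Set.Finite.subset (((Set.finite_Icc ((pos w).1 - 1) ((pos w).1 + 1)).prod
        (Set.finite_Icc ((pos w).2 - 1) ((pos w).2 + 1))).preimage (pos_injective k).injOn)
        fun v hv => ?_
      have hv' := shareFace_iff.1 hv
      simp only [abs_le] at hv'
      simp only [Set.mem_preimage, Set.mem_prod, Set.mem_Icc]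
      omega
    · rintro v ⟨w, hw, hvw⟩
      exact Set.mem_biUnion hw hvw

theorem core_subset_coreNet (e : Exponents) (hk : e.Preserves k) (ρ : ℕ) :
    core (m := 4) e k hk ⊆ coreNet e k hk ρ := by
  induction ρ with
  | zero => exact subset_rfl
  | succ ρ ih => exact fun v hv => ⟨v, ih hv, shareFace_refl v⟩

end Nets

/-! ### The subdominant eigenvalue in valence four -/

section Spectrum

variable {e : Exponents} (hav : 1 ≤ e.totalA + e.totalV) (hvr : 1 ≤ e.totalV + e.totalR)
  (hv : Even e.totalV) {k : Kind} (hk : e.Preserves k) (ρ : ℕ)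

include hvr in
-- The affine approximation needs a bounded mesh on all vertices; finiteness of the net makes the
-- extension by zero one.
theorem exists_bounded_extension (x : coreNet (m := 4) e k hk ρ → ℂ) :
    ∃ f : Mesh 4 k, restrict _ f = x ∧ ∃ B, ∀ v, ‖f v‖ ≤ B := by
  have := (finite_coreNet hvr hk ρ).to_subtype
  refine ⟨Function.extend Subtype.val x 0, ?_, ?_⟩
  · funext v
    exact Subtype.val_injective.extend_apply x 0 v
  · obtain ⟨B, hB⟩ := (Set.finite_range fun v => ‖x v‖).bddAbove
    refine ⟨max B 0, fun v => ?_⟩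
    by_cases h : v ∈ coreNet e k hk ρ
    · have := Subtype.val_injective.extend_apply x 0 (⟨v, h⟩ : coreNet (m := 4) e k hk ρ)
      simp only at this
      rw [this]
      exact (hB ⟨_, rfl⟩).trans (le_max_left _ _)
    · rw [Function.extend_apply' _ _ _ (by simpa using h)]
      simp

include hav hvr hv in
/-- Away from the eigenvalues `1` and `σ`, the iterates decay faster than the powers of `σ`. -/
theorem eq_zero_of_eigenvector {x y : coreNet (m := 4) e k hk ρ → ℂ} {ν : ℂ}
    (hν : e.sigma ≤ ‖ν‖)
    (hy : y = (subdivisionMatrix e k hk ρ - 1) ((subdivisionMatrix e k hk ρ - (e.sigma : ℂ) • 1) x))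
    (hyν : subdivisionMatrix e k hk ρ y = ν • y) : y = 0 := by
  set T := subdivisionMatrix (m := 4) e k hk ρ with hT
  set U := subdivide (m := 4) e k hk with hU
  have hinv := isInvariant_coreNet e hk ρ
  have hσ := sigma_pos e
  have hUc : Continuous U := (isAveraging_subdivide e k hk).continuous
  obtain ⟨f, hf, B, hB⟩ := exists_bounded_extension hvr hk ρ x
  obtain ⟨t, a, b, hlim⟩ := exists_affine_approximation e hav hvr k hk hB
  -- This annihilates affine meshes and commutes with U, so applying it to the approximation leaves
  -- U^n (A f) = o(σ^n), with y the restriction of A f.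
  set A : Module.End ℂ (Mesh 4 k) := (U - 1) * (U - (e.sigma : ℂ) • 1) with hA
  have hAc : Continuous A := by
    have : ⇑A = fun f => U (U f - (e.sigma : ℂ) • f) - (U f - (e.sigma : ℂ) • f) := rfl
    rw [this]
    fun_prop
  have hA0 (t a b : ℂ) : A (affineMesh k t a b) = 0 := by
    have h1 := subdivide_affineMesh e hv k hk
    have h2 : A (affineMesh k t a b) = U (U (affineMesh k t a b)) -
        (e.sigma : ℂ) • U (affineMesh k t a b) - (U (affineMesh k t a b) -
        (e.sigma : ℂ) • affineMesh k t a b) := by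
      rw [← map_smul, ← map_sub]
      rfl
    rw [h2, hU, h1, h1]
    simp only [affineMesh]
    module
  have hcomm (n : ℕ) : A ((U ^ n) f) = (U ^ n) (A f) := by
    have : Commute A (U ^ n) := by
      refine Commute.pow_right ?_ n
      refine Commute.mul_left ?_ ?_
      · exact (Commute.refl U).sub_left (Commute.one_left U)
      · exact (Commute.refl U).sub_left ((Commute.one_left U).smul_left _)
    exact congrArg (fun S : Module.End ℂ (Mesh 4 k) => S f) this.eq
  have hAf : restrict (coreNet e k hk ρ) (A f) = y := by
    have h1 (g : Mesh 4 k) (c : ℂ) : restrict (coreNet e k hk ρ) ((U - c • 1) g) =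
        (T - c • 1) (restrict _ g) := by
      rw [LinearMap.sub_apply, LinearMap.sub_apply, hT, subdivisionMatrix_restrict hinv]
      rfl
    have h2 := h1 ((U - (e.sigma : ℂ) • 1) f) 1
    rw [h1 f, hf, one_smul, one_smul, ← hy] at h2
    exact h2
  have hpow (n : ℕ) : (T ^ n) y = ν ^ n • y := by
    induction n with
    | zero => simp
    | succ n ih => rw [pow_succ', Module.End.mul_apply, ih, map_smul, hyν, smul_smul, pow_succ]
  have hlim2 : Tendsto (fun n => ((e.sigma : ℂ) ^ n)⁻¹ • (U ^ n) (A f)) atTop (𝓝 0) := by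
    have := (hAc.tendsto 0).comp hlim
    rw [map_zero] at this
    refine this.congr fun n => ?_
    rw [Function.comp_apply, map_smul, map_sub, hA0, sub_zero, hcomm]
  funext v
  have h3 : Tendsto (fun n => ((e.sigma : ℂ) ^ n)⁻¹ * (ν ^ n * y v)) atTop (𝓝 0) := by
    refine (tendsto_pi_nhds.1 hlim2 v.1).congr fun n => ?_
    have h4 := subdivisionMatrix_pow_restrict hinv n (A f)
    rw [hAf, hpow] at h4
    exact congrArg (fun z => ((e.sigma : ℂ) ^ n)⁻¹ * z) (congrFun h4 v).symm
  -- A constant sequence, dominated by (‖ν‖/σ)^n ‖y v‖, which tends to zero.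
  have h5 : Tendsto (fun n : ℕ => ‖y v‖) atTop (𝓝 0) := by
    refine squeeze_zero (fun _ => norm_nonneg _) (fun n => ?_) (tendsto_zero_iff_norm_tendsto_zero.1 h3)
    rw [norm_mul, norm_mul, norm_inv, norm_pow, norm_pow, Complex.norm_real,
      Real.norm_of_nonneg hσ.le, ← mul_assoc, inv_mul_eq_div]
    refine le_mul_of_one_le_left (norm_nonneg _) ?_
    rw [one_le_div (by positivity)]
    gcongr
  exact norm_eq_zero.1 (tendsto_nhds_unique tendsto_const_nhds h5)

include hav hvr hv in
theorem eq_of_fixed {x : coreNet (m := 4) e k hk ρ → ℂ}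
    (hx : subdivisionMatrix e k hk ρ x = x) (v w : coreNet (m := 4) e k hk ρ) : x v = x w := by
  set U := subdivide (m := 4) e k hk with hU
  have hinv := isInvariant_coreNet e hk ρ
  have hσ := sigma_pos e
  have hσ1 := sigma_lt_one hvr
  obtain ⟨f, hf, B, hB⟩ := exists_bounded_extension hvr hk ρ x
  obtain ⟨t, a, b, hlim⟩ := exists_affine_approximation e hav hvr k hk hB
  -- This removes the linear part of an affine mesh and multiplies constants and fixed meshes by 1 -
  -- σ. So (1 - σ)x is a limit of constants up to o(1), and σ ≠ 1 gives that x is constant.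
  set A : Module.End ℂ (Mesh 4 k) := U - (e.sigma : ℂ) • 1 with hA
  have hUc : Continuous U := (isAveraging_subdivide e k hk).continuous
  have hAc : Continuous A := by
    have : ⇑A = fun f => U f - (e.sigma : ℂ) • f := rfl
    rw [this]
    fun_prop
  have hA0 (t a b : ℂ) : A (affineMesh k t a b) = ((1 - e.sigma : ℂ) * t) • 1 := by
    have h2 : A (affineMesh k t a b) = U (affineMesh k t a b) -
        (e.sigma : ℂ) • affineMesh k t a b := rfl
    rw [h2, hU, subdivide_affineMesh e hv k hk]
    simp only [affineMesh]
    module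
  have hpow (n : ℕ) : restrict (coreNet e k hk ρ) ((U ^ n) f) = x := by
    rw [hU, ← subdivisionMatrix_pow_restrict hinv, hf]
    induction n with
    | zero => rfl
    | succ n ih => rw [pow_succ, Module.End.mul_apply, hx, ih]
  have hAx (n : ℕ) : restrict (coreNet e k hk ρ) (A ((U ^ n) f)) = (1 - e.sigma : ℂ) • x := by
    have h2 : A ((U ^ n) f) = (U ^ (n + 1)) f - (e.sigma : ℂ) • (U ^ n) f := by
      rw [pow_succ']
      rfl
    rw [h2, map_sub, map_smul, hpow, hpow]
    module
  have hlim2 : Tendsto (fun n => A ((U ^ n) f) - ((1 - e.sigma : ℂ) * t n) • 1) atTop (𝓝 0) := by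
    have h1 : Tendsto (fun n : ℕ => (e.sigma : ℂ) ^ n) atTop (𝓝 0) :=
      tendsto_pow_atTop_nhds_zero_of_norm_lt_one (by
        rwa [Complex.norm_real, Real.norm_of_nonneg hσ.le])
    have h2 := h1.smul ((hAc.tendsto 0).comp hlim)
    rw [zero_smul] at h2
    refine h2.congr fun n => ?_
    have : (e.sigma : ℂ) ^ n ≠ 0 := pow_ne_zero _ (by exact_mod_cast hσ.ne')
    rw [Function.comp_apply, map_smul, map_sub, hA0, smul_inv_smul₀ this]
  have h3 (v : coreNet (m := 4) e k hk ρ) :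
      Tendsto (fun n => (1 - e.sigma : ℂ) * x v - (1 - e.sigma : ℂ) * t n) atTop (𝓝 0) := by
    refine (tendsto_pi_nhds.1 hlim2 v.1).congr fun n => ?_
    have := congrFun (hAx n) v
    rw [restrict_apply, Pi.smul_apply, smul_eq_mul] at this
    rw [Pi.sub_apply, this]
    simp
  have h4 := (h3 v).sub (h3 w)
  rw [sub_zero] at h4
  have h5 : (1 - e.sigma : ℂ) * (x v - x w) = 0 :=
    tendsto_nhds_unique (tendsto_const_nhds.congr fun n => by ring) h4
  refine sub_eq_zero.1 ((mul_eq_zero.1 h5).resolve_left fun h => ?_)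
  have : (1 - e.sigma : ℝ) = 0 := by exact_mod_cast h
  linarith

include hav hvr hv in
theorem isSubdominantEigenvalue_sigma :
    IsSubdominantEigenvalue (subdivisionMatrix (m := 4) e k hk ρ) (e.sigma : ℂ) := by
  set T := subdivisionMatrix (m := 4) e k hk ρ with hT
  have hinv := isInvariant_coreNet e hk ρ
  have hσ := sigma_pos e
  have hσ1 := sigma_lt_one hvr
  have hσn : ‖(e.sigma : ℂ)‖ = e.sigma := by
    rw [Complex.norm_real, Real.norm_of_nonneg hσ.le]
  have hσC : (1 - e.sigma : ℂ) ≠ 0 := by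
    intro h
    have : (1 - e.sigma : ℝ) = 0 := by exact_mod_cast h
    linarith
  obtain ⟨v₀, hv₀, hz⟩ := exists_mem_core_gridMesh_ne_zero segmentAngle_four e hav k hk
  have hv₀' := core_subset_coreNet e hk ρ hv₀
  set u : coreNet (m := 4) e k hk ρ → ℂ := restrict _ 1 with hu
  have hTu : T u = u := by
    rw [hT, hu, subdivisionMatrix_restrict hinv, (isAveraging_subdivide e k hk).map_one]
  have hu0 : u ≠ 0 := fun h => one_ne_zero (congrFun h ⟨v₀, hv₀'⟩)
  have hcomm (x : coreNet (m := 4) e k hk ρ → ℂ) : (T - 1) ((T - (e.sigma : ℂ) • 1) x) =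
      (T - (e.sigma : ℂ) • 1) ((T - 1) x) := by
    simp only [LinearMap.sub_apply, LinearMap.smul_apply, Module.End.one_apply, map_sub, map_smul]
    module
  -- There is no Jordan block for 1: (T - 1)x is fixed, and its multiple by 1 - σ lies in the image
  -- of (T - 1)(T - σ), so it vanishes.
  have hsq (x : coreNet (m := 4) e k hk ρ → ℂ) (h : (T - 1) ((T - 1) x) = 0) :
      (T - 1) x = 0 := by
    set h' := (T - 1) x with hh'
    have h1 : T h' = h' := sub_eq_zero.1 h
    have h2 : (T - (e.sigma : ℂ) • 1) h' = (1 - e.sigma : ℂ) • h' := by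
      rw [LinearMap.sub_apply, h1, LinearMap.smul_apply, Module.End.one_apply, sub_smul, one_smul]
    have h3 := eq_zero_of_eigenvector hav hvr hv hk ρ (x := x) (y := (1 - e.sigma : ℂ) • h')
      (ν := 1) (by rw [norm_one]; exact hσ1.le) (by rw [← hT, hcomm, ← hh', h2])
      (by rw [← hT, map_smul, h1, one_smul])
    exact (smul_eq_zero.1 h3).resolve_left hσC
  have hmax : T.maxGenEigenspace 1 = Submodule.span ℂ {u} := by
    apply le_antisymm
    · intro x hx
      obtain ⟨n, hn⟩ := (Module.End.mem_maxGenEigenspace T 1 x).1 hx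
      rw [one_smul] at hn
      have hfix : T x = x := by
        rw [← sub_eq_zero]
        change (T - 1) x = 0
        induction n with
        | zero =>
          have : x = 0 := hn
          rw [this, map_zero]
        | succ n ih =>
          rcases n with _ | n
          · simpa using hn
          · refine ih ?_
            rw [pow_succ', pow_succ', Module.End.mul_apply, Module.End.mul_apply] at hn
            rw [pow_succ', Module.End.mul_apply]
            exact hsq _ hn
      rw [Submodule.mem_span_singleton]
      refine ⟨x ⟨v₀, hv₀'⟩, ?_⟩
      funext v
      rw [Pi.smul_apply, smul_eq_mul, hu, restrict_apply, Pi.one_apply, mul_one]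
      exact eq_of_fixed hav hvr hv hk ρ hfix _ _
    · rw [Submodule.span_singleton_le_iff_mem, Module.End.mem_maxGenEigenspace]
      refine ⟨1, ?_⟩
      rw [pow_one, one_smul, LinearMap.sub_apply, hTu, Module.End.one_apply, sub_self]
  refine ⟨1, ?_, ?_, ?_, ?_, ?_⟩
  · refine Module.End.hasEigenvalue_of_hasEigenvector (x := u) ⟨?_, hu0⟩
    rw [Module.End.mem_eigenspace_iff, hTu, one_smul]
  · rw [hmax, finrank_span_singleton hu0]
  · refine Module.End.hasEigenvalue_of_hasEigenvector (x := restrict _ (gridMesh 1 k))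
      ⟨?_, fun h => hz (congrFun h ⟨v₀, hv₀'⟩)⟩
    rw [Module.End.mem_eigenspace_iff, hT, subdivisionMatrix_restrict hinv,
      subdivide_gridMesh segmentAngle_four e hv, map_smul]
  · rw [hσn, norm_one]
    exact hσ1
  · intro ν hν h1 h2
    by_contra! hle
    rw [hσn] at hle
    obtain ⟨x, hx⟩ := hν.exists_hasEigenvector
    have hxe : T x = ν • x := hx.apply_eq_smul
    -- On an eigenvector, (T - 1)(T - σ) is multiplication by (ν - 1)(ν - σ), which must therefore
    -- be zero.
    have h3 := eq_zero_of_eigenvector hav hvr hv hk ρ (x := x)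
      (y := ((ν - 1) * (ν - e.sigma)) • x) hle (by
        rw [← hT]
        simp only [LinearMap.sub_apply, LinearMap.smul_apply, Module.End.one_apply, map_sub,
          map_smul, hxe]
        module) (by
        rw [← hT, map_smul, hxe, smul_comm])
    rcases smul_eq_zero.1 h3 with h4 | h4
    · rcases mul_eq_zero.1 h4 with h5 | h5
      · exact h1 (sub_eq_zero.1 h5)
      · exact h2 (sub_eq_zero.1 h5)
    · exact hx.2 h4

end Spectrum

end MidpointSubdivision

end

theorem mainTheorem9 (e : MidpointSubdivision.Exponents)
    (hav : 1 ≤ e.totalA + e.totalV) (hvr : 1 ≤ e.totalV + e.totalR) (hv : Even e.totalV)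
    (k : MidpointSubdivision.Kind) (hk : e.Preserves k) :
    (∀ ρ : ℕ, MidpointSubdivision.IsSubdominantEigenvalue
        (MidpointSubdivision.subdivisionMatrix (m := 4) e k hk ρ) (e.sigma : ℂ)) ∧
      ∀ (m : ℕ) [NeZero m] (f : ℕ), 2 * (f : ℝ) * Real.pi / (m : ℝ) = Real.pi / 2 →
        MidpointSubdivision.IsLambda m e k hk f e.sigma := by
  exact ⟨fun ρ => MidpointSubdivision.isSubdominantEigenvalue_sigma hav hvr hv hk ρ,
    fun m _ f hφ => MidpointSubdivision.isLambda_sigma hφ e hav hv k hk⟩
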